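/- In this statement graphs are finite and may have loops and multiple edges; $d_G(v)$ is the degree of $v$ (loops counted twice), a factor is a spanning subgraph, and $G$ is $m$-edge-connected if every edge cut between a nonempty proper vertex subset and its complement has at least $m$ edges. For $A\subseteq V(G)$, $e_G(A)$ is the number of edges (loops included) with both ends in $A$. The bipartite index $bi(G)$ is the minimum of $|E(G)\setminus E(H)|$ over all bipartite factors $H$ of $G$. For a positive integer $k$, a mapping $f:V(G)\to \mathbb{Z}_k$ is compatible with $G$ if for every partition of $V(G)$ into two (possibly empty) sets $X,Y$, either $\sum_{v\in X}f(v)-2x\equiv\sum_{v\in Y}f(v) \pmod k$ for some integer $0\le x\le e_G(X)$, or $\sum_{v\in X}f(v)\equiv\sum_{v\in Y}f(v)-2y \pmod k$ for some integer $0\le y\le e_G(Y)$. Let $k$ be a positive integer, let $G$ be a $(6k-7)$-edge-connected graph, and let $f:V(G)\to\mathbb{Z}_k$ be a mapping. Assume that at least one of the following conditions holds: (1) $f$ is compatible with $G$; (2) $(k-1)\sum_{v\in V(G)}f(v)$ is even and $bi(G)\ge k-1$; (3) $k$ is even, $(k-1)\sum_{v\in V(G)}f(v)$ is even and $bi(G)\ge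 k/2-1$. (In the parity conditions the values of $f$ are represented by integers in $\{0,\dots,k-1\}$.) Then $G$ has a factor $H$ such that for every vertex $v$, $d_H(v)\equiv f(v) \pmod k$ and $$\Big\lfloor \frac{d_G(v)}{2}\Big\rfloor-(k-1)\le d_H(v)\le \Big\lfloor \frac{d_G(v)}{2}\Big\rfloor+k.$$ -/

import Mathlib

open scoped Graph

namespace ModFactor

variable {α β : Type*}

/-- The degree of `v` in the multigraph `G`: the number of edges incident with `v`,
every loop being counted twice. -/
noncomputable def degree (G : Graph α β) (v : α) : ℕ :=
  {e | G.Inc e v}.ncard + {e | G.IsLoopAt e v}.ncard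

/-- The number `d_G(A)` of edges of `G` with exactly one end in `A`. -/
noncomputable def cutSize (G : Graph α β) (A : Set α) : ℕ :=
  {e | ∃ x y, G.IsLink e x y ∧ x ∈ A ∧ y ∉ A}.ncard

/-- The number `e_G(A)` of edges of `G` with both ends in `A` (loops included). -/
noncomputable def inducedSize (G : Graph α β) (A : Set α) : ℕ :=
  {e | ∃ x y, G.IsLink e x y ∧ x ∈ A ∧ y ∈ A}.ncard

/-- `G` is `m`-edge-connected: every edge cut between a nonempty proper vertex subset and
its complement has at least `m` edges (equivalently, for a finite graph on a nonempty vertex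
set and `0 < m`, deleting fewer than `m` edges never disconnects the graph).
The parameter is an integer, and the condition is void for `m ≤ 0`. -/
def IsEdgeConnected (G : Graph α β) (m : ℤ) : Prop :=
  ∀ A : Set α, A ⊂ V(G) → A.Nonempty → m ≤ (cutSize G A : ℤ)

/-- `X, Y` is a bipartition of the vertex set of `G` (a side may be empty, and edges inside
the sides are allowed). -/
def IsVertexBipartition (G : Graph α β) (X Y : Set α) : Prop :=
  X ∪ Y = V(G) ∧ Disjoint X Y

/-- `G` is a bipartite graph. -/
def IsBipartite (G : Graph α β) : Prop :=
  ∃ X Y : Set α, IsVertexBipartition G X Y ∧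
    ∀ e x y, G.IsLink e x y → (x ∈ X ∧ y ∈ Y) ∨ (x ∈ Y ∧ y ∈ X)

/-- The bipartite index `bi(G)`: the smallest value of `|E(G) \ E(H)|` over all bipartite
factors (spanning subgraphs) `H` of `G`. -/
noncomputable def bipartiteIndex (G : Graph α β) : ℕ :=
  sInf {n : ℕ | ∃ H : Graph α β, H ≤s G ∧ IsBipartite H ∧ n = (E(G) \ E(H)).ncard}

/-- The mapping `f : V(G) → Z_k` is compatible with `G` with respect to the bipartition
`X, Y` of `V(G)`. -/
def IsCompatibleWrt {k : ℕ} (G : Graph α β) (f : α → ZMod k) (X Y : Set α) : Prop :=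
  (∃ x : ℕ, x ≤ inducedSize G X ∧
    (∑ᶠ v ∈ X, f v) - 2 * (x : ZMod k) = ∑ᶠ v ∈ Y, f v) ∨
  (∃ y : ℕ, y ≤ inducedSize G Y ∧
    (∑ᶠ v ∈ X, f v) = (∑ᶠ v ∈ Y, f v) - 2 * (y : ZMod k))

/-- The mapping `f : V(G) → Z_k` is compatible with `G`, that is, with respect to every
bipartition of `V(G)`. -/
def IsCompatible {k : ℕ} (G : Graph α β) (f : α → ZMod k) : Prop :=
  ∀ X Y : Set α, IsVertexBipartition G X Y → IsCompatibleWrt G f X Y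

/-- `H` is an `f`-factor of `G` modulo `k`: a spanning subgraph of `G` whose degree at every
vertex `v` is congruent to `f v` modulo `k`. -/
def IsModFactor {k : ℕ} (G : Graph α β) (f : α → ZMod k) (H : Graph α β) : Prop :=
  H ≤s G ∧ ∀ v ∈ V(G), (degree H v : ZMod k) = f v

/-- `G` has an `f`-factor `H` modulo `k` with
`⌊d_G(v)/2⌋ - (k - 1) ≤ d_H(v) ≤ ⌊d_G(v)/2⌋ + k` for every vertex `v`. -/
def HasBoundedModFactor {k : ℕ} (G : Graph α β) (f : α → ZMod k) : Prop :=
  ∃ H : Graph α β, IsModFactor G f H ∧ ∀ v ∈ V(G),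
    ((degree G v / 2 : ℕ) : ℤ) - ((k : ℤ) - 1) ≤ (degree H v : ℤ) ∧
    (degree H v : ℤ) ≤ ((degree G v / 2 : ℕ) : ℤ) + (k : ℤ)

end ModFactor

namespace ModFactor

section Core

variable {V : Type*} [DecidableEq V]

/-- The number of edges leaving `A`: free edges (with multiplicities `m`) from `A` to `T \ A`
together with the edges at `A` whose orientation is already fixed (`c v` of them at `v`). -/
def boundary (T : Finset V) (m : V → V → ℤ) (c : V → ℤ) (A : Finset V) : ℤ :=
  ∑ u ∈ A, ∑ v ∈ T \ A, m u v + ∑ u ∈ A, c u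

/-- The hypotheses of the bounded modular orientation theorem. On the vertex set `T` there are
`m u v` free edges between `u` and `v`, and `c v` fixed edges at `v` with net flow `g v`; the
demand is `τ`, to be met modulo `2 * k`, and `x` is an exempt vertex. -/
structure IsAdmissible (k : ℤ) (T : Finset V) (x : Option V) (m : V → V → ℤ)
    (c g τ : V → ℤ) : Prop where
  symm : ∀ u v, m u v = m v u
  nonneg : ∀ u v, 0 ≤ m u v
  diag : ∀ u, m u u = 0
  fixed_le : ∀ v ∈ T, |g v| ≤ c v
  fixed_even : ∀ v ∈ T, 2 ∣ c v + g v
  even : ∀ v ∈ T, 2 ∣ τ v + boundary T m c {v}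
  total : 2 * k ∣ ∑ v ∈ T, τ v - ∑ v ∈ T, g v
  root : ∀ j : ℤ, ∑ v ∈ T, c v ≤ 2 * k - 2 + |∑ v ∈ T, g v - 2 * k * j|
  cut : ∀ A ⊆ T, A ≠ T → A.Nonempty → (∀ v, x = some v → A ≠ {v}) →
    ∃ j : ℤ, |∑ v ∈ A, τ v - 2 * k * j| + 2 * k - 2 ≤ boundary T m c A
  exempt : ∀ v ∈ T, x = some v → 2 * k ∣ τ v

/-- `f u v` is the net flow from `u` to `v` of an orientation of the free edges. -/
structure IsFlow (T : Finset V) (m f : V → V → ℤ) : Prop where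
  antisymm : ∀ u v, f u v = -f v u
  le : ∀ u ∈ T, ∀ v ∈ T, |f u v| ≤ m u v
  even : ∀ u ∈ T, ∀ v ∈ T, 2 ∣ f u v + m u v

def HasFlow (k : ℤ) (T : Finset V) (m : V → V → ℤ) (g τ : V → ℤ) : Prop :=
  ∃ f, IsFlow T m f ∧ ∀ v ∈ T, 2 * k ∣ ∑ u ∈ T, f v u + g v - τ v ∧
    |∑ u ∈ T, f v u + g v| < 2 * k

/-- The set `A` exceeds the required boundary size. -/
def IsSlack (k : ℤ) (T : Finset V) (m : V → V → ℤ) (c τ : V → ℤ) (A : Finset V) : Prop :=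
  ∃ j : ℤ, |∑ v ∈ A, τ v - 2 * k * j| + 2 * k ≤ boundary T m c A

def unitAt (a v : V) : ℤ := if v = a then 1 else 0

def edgeAt (a b u v : V) : ℤ :=
  (if u = a ∧ v = b then 1 else 0) + (if u = b ∧ v = a then 1 else 0)

def arcAt (a b u v : V) : ℤ :=
  (if u = a ∧ v = b then 1 else 0) - (if u = b ∧ v = a then 1 else 0)

lemma sum_unitAt (A : Finset V) (a : V) : ∑ v ∈ A, unitAt a v = if a ∈ A then 1 else 0 := by
  simp [unitAt]

lemma sum_pair_ite (A B : Finset V) (a b : V) :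
    ∑ u ∈ A, ∑ v ∈ B, (if u = a ∧ v = b then (1 : ℤ) else 0) =
      if a ∈ A ∧ b ∈ B then 1 else 0 := by
  simp only [ite_and, Finset.sum_ite_irrel, Finset.sum_ite_eq', Finset.sum_const_zero]

lemma sum_row_ite (B : Finset V) (a b u : V) (hb : b ∈ B) :
    ∑ v ∈ B, (if u = a ∧ v = b then (1 : ℤ) else 0) = if u = a then 1 else 0 := by
  simp only [ite_and, Finset.sum_ite_irrel, Finset.sum_ite_eq', Finset.sum_const_zero, hb, if_true]

lemma sum_arcAt {T : Finset V} {a b : V} (ha : a ∈ T) (hb : b ∈ T) (v : V) :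
    ∑ u ∈ T, arcAt a b v u = unitAt a v - unitAt b v := by
  simp only [arcAt, Finset.sum_sub_distrib, sum_row_ite _ _ _ _ ha, sum_row_ite _ _ _ _ hb, unitAt]

lemma sum_cross_edgeAt {T A : Finset V} {a b : V} (ha : a ∈ T) (hb : b ∈ T) :
    ∑ u ∈ A, ∑ v ∈ T \ A, edgeAt a b u v = if (a ∈ A ↔ b ∈ A) then 0 else 1 := by
  simp only [edgeAt, Finset.sum_add_distrib, sum_pair_ite, Finset.mem_sdiff, ha, hb, true_and]
  by_cases h1 : a ∈ A <;> by_cases h2 : b ∈ A <;> simp [h1, h2]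

lemma sum_edgeAt {T : Finset V} {a b : V} (ha : a ∈ T) (hb : b ∈ T) :
    ∑ u ∈ T, ∑ v ∈ T, edgeAt a b u v = 2 := by
  simp only [edgeAt, Finset.sum_add_distrib, sum_pair_ite, ha, hb]
  norm_num

lemma edgeAt_symm (a b u v : V) : edgeAt a b u v = edgeAt a b v u := by
  simp only [edgeAt]; rw [add_comm]; simp only [and_comm]

lemma edgeAt_self {a b : V} (hab : a ≠ b) (u : V) : edgeAt a b u u = 0 := by
  simp only [edgeAt]; grind

lemma edgeAt_nonneg (a b u v : V) : 0 ≤ edgeAt a b u v := by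
  simp only [edgeAt]; split_ifs <;> simp

lemma arcAt_antisymm (a b u v : V) : arcAt a b u v = -arcAt a b v u := by
  simp only [arcAt, neg_sub, and_comm]

lemma edgeAt_cases {a b : V} (hab : a ≠ b) (u v : V) :
    (u = a ∧ v = b ∧ edgeAt a b u v = 1 ∧ arcAt a b u v = 1) ∨
    (u = b ∧ v = a ∧ edgeAt a b u v = 1 ∧ arcAt a b u v = -1) ∨
    (edgeAt a b u v = 0 ∧ arcAt a b u v = 0) := by
  simp only [edgeAt, arcAt]; split_ifs <;> simp_all

lemma boundary_sub_edgeAt {T A : Finset V} (m : V → V → ℤ) (c : V → ℤ) {a b : V} (ha : a ∈ T)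
    (hb : b ∈ T) : boundary T (fun u v => m u v - edgeAt a b u v) c A =
      boundary T m c A - if (a ∈ A ↔ b ∈ A) then 0 else 1 := by
  simp only [boundary, Finset.sum_sub_distrib, sum_cross_edgeAt ha hb]; ring

lemma boundary_add_edgeAt {T A : Finset V} (m : V → V → ℤ) (c : V → ℤ) {a b : V} (ha : a ∈ T)
    (hb : b ∈ T) : boundary T (fun u v => m u v + edgeAt a b u v) c A =
      boundary T m c A + if (a ∈ A ↔ b ∈ A) then 0 else 1 := by
  simp only [boundary, Finset.sum_add_distrib, sum_cross_edgeAt ha hb]; ring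

lemma boundary_fixed {T A : Finset V} (m : V → V → ℤ) (c d : V → ℤ) :
    boundary T m (fun v => c v + d v) A = boundary T m c A + ∑ v ∈ A, d v := by
  simp only [boundary, Finset.sum_add_distrib]; ring

lemma two_dvd_sum_symm (m : V → V → ℤ) (hs : ∀ u v, m u v = m v u) (hd : ∀ u, m u u = 0)
    (A : Finset V) : (2 : ℤ) ∣ ∑ u ∈ A, ∑ v ∈ A, m u v := by
  induction A using Finset.induction_on with
  | empty => simp
  | insert a A ha ih =>
    have h : ∑ u ∈ insert a A, ∑ v ∈ insert a A, m u v =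
        2 * ∑ v ∈ A, m a v + ∑ u ∈ A, ∑ v ∈ A, m u v := by
      simp only [Finset.sum_insert ha, Finset.sum_add_distrib, hd]
      rw [Finset.sum_congr rfl fun u _ => hs u a]; ring
    rw [h]
    exact dvd_add (dvd_mul_right _ _) ih

lemma boundary_add_sum {T A : Finset V} (hA : A ⊆ T) (m : V → V → ℤ) (c : V → ℤ) :
    boundary T m c A + ∑ u ∈ A, ∑ v ∈ A, m u v = ∑ u ∈ A, ∑ v ∈ T, m u v + ∑ u ∈ A, c u := by
  have h : ∀ u ∈ A, ∑ v ∈ T, m u v = ∑ v ∈ T \ A, m u v + ∑ v ∈ A, m u v :=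
    fun u _ => (Finset.sum_sdiff hA).symm
  rw [Finset.sum_congr rfl h, Finset.sum_add_distrib, boundary]; ring

lemma boundary_singleton {T : Finset V} {m : V → V → ℤ} (c : V → ℤ) (hd : ∀ u, m u u = 0) {v : V}
    (hv : v ∈ T) : boundary T m c {v} = ∑ u ∈ T, m v u + c v := by
  have := boundary_add_sum (Finset.singleton_subset_iff.2 hv) m c
  simpa [hd] using this

/-- The reduction order for admissible data. -/
def Smaller (T' : Finset V) (m' : V → V → ℤ) (c' : V → ℤ) (T : Finset V) (m : V → V → ℤ)
    (c : V → ℤ) : Prop :=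
  T'.card < T.card ∨ T' = T ∧ (∑ u ∈ T, ∑ v ∈ T, m' u v < ∑ u ∈ T, ∑ v ∈ T, m u v ∨
    ∑ u ∈ T, ∑ v ∈ T, m' u v = ∑ u ∈ T, ∑ v ∈ T, m u v ∧ ∑ v ∈ T, c' v < ∑ v ∈ T, c v)

def AllSmaller (k : ℤ) (T : Finset V) (m : V → V → ℤ) (c : V → ℤ) : Prop :=
  ∀ T' x' m' c' g' τ', IsAdmissible k T' x' m' c' g' τ' → Smaller T' m' c' T m c →
    HasFlow k T' m' g' τ'

variable {k : ℤ} {T : Finset V} {x : Option V} {m : V → V → ℤ} {c g τ : V → ℤ}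

lemma two_dvd_sum_add_boundary (hs : ∀ u v, m u v = m v u) (hd : ∀ u, m u u = 0)
    (h : ∀ v ∈ T, 2 ∣ τ v + boundary T m c {v}) {A : Finset V} (hA : A ⊆ T) :
    2 ∣ ∑ v ∈ A, τ v + boundary T m c A := by
  have h1 : 2 ∣ ∑ v ∈ A, (τ v + (∑ u ∈ T, m v u + c v)) := by
    refine Finset.dvd_sum fun v hv => ?_
    rw [← boundary_singleton c hd (hA hv)]
    exact h v (hA hv)
  have h2 := boundary_add_sum hA m c
  have h3 := two_dvd_sum_symm m hs hd A
  simp only [Finset.sum_add_distrib] at h1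
  omega

lemma IsAdmissible.le_of_not_isSlack (h : IsAdmissible k T x m c g τ) {A : Finset V} (hA : A ⊆ T)
    (hs : ¬ IsSlack k T m c τ A) (j : ℤ) :
    boundary T m c A ≤ 2 * k - 2 + |∑ v ∈ A, τ v - 2 * k * j| := by
  have h1 := two_dvd_sum_add_boundary h.symm h.diag h.even hA
  by_contra hc
  apply hs
  refine ⟨j, ?_⟩
  obtain ⟨i, hi⟩ := h1
  have e : 2 * k * j = 2 * (k * j) := by ring
  rw [e] at hc ⊢
  rcases abs_cases (∑ v ∈ A, τ v - 2 * (k * j)) with h' | h' <;> omega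

lemma IsAdmissible.fixed_nonneg (h : IsAdmissible k T x m c g τ) {v : V} (hv : v ∈ T) : 0 ≤ c v :=
  (abs_nonneg _).trans (h.fixed_le v hv)

lemma exists_sign {g c : ℤ} (h : |g| ≤ c) (hc : 0 < c) (h2 : 2 ∣ c + g) :
    ∃ s : ℤ, (s = 1 ∨ s = -1) ∧ |g - s| ≤ c - 1 := by
  rw [abs_le] at h
  rcases lt_or_ge 0 g with hg | hg
  · exact ⟨1, Or.inl rfl, by rw [abs_le]; omega⟩
  · exact ⟨-1, Or.inr rfl, by rw [abs_le]; omega⟩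


lemma IsFlow.add_edge {f : V → V → ℤ} {a b : V} {s : ℤ} (hs : s = 1 ∨ s = -1) (hab : a ≠ b)
    (hf : IsFlow T (fun u v => m u v - edgeAt a b u v) f) :
    IsFlow T m (fun u v => f u v + s * arcAt a b u v) where
  antisymm u v := by
    have := hf.antisymm u v
    rw [this, arcAt_antisymm]; ring
  le u hu v hv := by
    have := hf.le u hu v hv
    rw [abs_le] at this ⊢
    rcases edgeAt_cases hab u v with ⟨-, -, h1, h2⟩ | ⟨-, -, h1, h2⟩ | ⟨h1, h2⟩ <;>
      rcases hs with rfl | rfl <;> rw [h1] at this <;> rw [h2] <;> omega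
  even u hu v hv := by
    have := hf.even u hu v hv
    rcases edgeAt_cases hab u v with ⟨-, -, h1, h2⟩ | ⟨-, -, h1, h2⟩ | ⟨h1, h2⟩ <;>
      rcases hs with rfl | rfl <;> rw [h1] at this <;> rw [h2] <;> omega

lemma IsFlow.remove_edge {f : V → V → ℤ} {a b : V} (hab : a ≠ b) (ha : a ∈ T) (hb : b ∈ T)
    (hs : m a b = m b a) (hm : 0 ≤ m a b)
    (hf : IsFlow T (fun u v => m u v + edgeAt a b u v) f) :
    ∃ s : ℤ, (s = 1 ∨ s = -1) ∧ IsFlow T m (fun u v => f u v - s * arcAt a b u v) := by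
  have key : ∃ s : ℤ, (s = 1 ∨ s = -1) ∧ |f a b - s| ≤ m a b := by
    have h1 := hf.le a ha b hb
    have h2 := hf.even a ha b hb
    have h3 : edgeAt a b a b = 1 := by simp [edgeAt, hab]
    obtain ⟨s, hs, h⟩ := exists_sign h1 (by simp only [h3]; omega) (by rwa [add_comm])
    exact ⟨s, hs, by simpa [h3] using h⟩
  obtain ⟨s, hs1, hs2⟩ := key
  refine ⟨s, hs1, fun u v => ?_, fun u hu v hv => ?_, fun u hu v hv => ?_⟩
  · rw [hf.antisymm u v, arcAt_antisymm]; ring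
  · have := hf.le u hu v hv
    have h4 := hf.antisymm a b
    rw [abs_le] at this hs2 ⊢
    rcases edgeAt_cases hab u v with ⟨rfl, rfl, h1, h2⟩ | ⟨rfl, rfl, h1, h2⟩ | ⟨h1, h2⟩ <;>
      rw [h1] at this <;> rw [h2] <;> omega
  · have := hf.even u hu v hv
    rcases edgeAt_cases hab u v with ⟨-, -, h1, h2⟩ | ⟨-, -, h1, h2⟩ | ⟨h1, h2⟩ <;>
      rcases hs1 with rfl | rfl <;> rw [h1] at this <;> rw [h2] <;> omega

lemma hasFlow_of_lift (h : IsAdmissible k T x m c g τ) (ih : AllSmaller k T m c) {v a b : V}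
    (hv : v ∈ T) (ha : a ∈ T) (hb : b ∈ T) (hva : v ≠ a) (hvb : v ≠ b) (hab : a ≠ b)
    (hma : 0 < m v a) (hmb : 0 < m v b)
    (H : ∀ A ⊆ T, A ≠ T → A.Nonempty → (∀ v, x = some v → A ≠ {v}) → (v ∈ A ∨ 2 ≤ A.card) →
      IsSlack k T m c τ A) : HasFlow k T m g τ := by
  set m' : V → V → ℤ := fun u w => m u w - edgeAt v a u w - edgeAt v b u w + edgeAt a b u w
    with hm'
  have hbd : ∀ A, boundary T m' c A = boundary T m c A - (if (v ∈ A ↔ a ∈ A) then 0 else 1) -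
      (if (v ∈ A ↔ b ∈ A) then 0 else 1) + if (a ∈ A ↔ b ∈ A) then 0 else 1 := by
    intro A
    rw [hm', boundary_add_edgeAt (fun u w => m u w - edgeAt v a u w - edgeAt v b u w) c ha hb,
      boundary_sub_edgeAt (fun u w => m u w - edgeAt v a u w) c hv hb,
      boundary_sub_edgeAt m c hv ha]
  have hadm : IsAdmissible k T x m' c g τ := by
    refine ⟨fun u w => ?_, fun u w => ?_, fun u => ?_, h.fixed_le, h.fixed_even, fun u hu => ?_,
      h.total, h.root, fun A hA hAT hA0 hAx => ?_, h.exempt⟩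
    · simp only [hm', h.symm u w, edgeAt_symm _ _ u w]
    · have h1 := h.nonneg u w
      have h2 := edgeAt_nonneg a b u w
      have h3 := h.symm v a
      have h4 := h.symm v b
      simp only [hm']
      rcases edgeAt_cases hva u w with ⟨rfl, rfl, e1, -⟩ | ⟨rfl, rfl, e1, -⟩ | ⟨e1, -⟩ <;>
      rcases edgeAt_cases hvb u w with ⟨h5, h6, e2, -⟩ | ⟨h5, h6, e2, -⟩ | ⟨e2, -⟩ <;>
        grind
    · simp only [hm', h.diag, edgeAt_self hva, edgeAt_self hvb, edgeAt_self hab]; rfl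
    · have := h.even u hu
      rw [hbd]
      split_ifs <;> first | omega | tauto
    · rw [hbd]
      by_cases hc : v ∈ A ∨ 2 ≤ A.card
      · obtain ⟨j, hj⟩ := H A hA hAT hA0 hAx hc
        exact ⟨j, by split_ifs <;> omega⟩
      · obtain ⟨j, hj⟩ := h.cut A hA hAT hA0 hAx
        refine ⟨j, ?_⟩
        have : ¬ (a ∈ A ∧ b ∈ A) := by
          rintro ⟨h1, h2⟩
          exact hc (Or.inr (Finset.one_lt_card.2 ⟨a, h1, b, h2, hab⟩))
        split_ifs <;> first | omega | tauto
  have hsm : Smaller T m' c T m c := by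
    refine Or.inr ⟨rfl, Or.inl ?_⟩
    simp only [hm', Finset.sum_add_distrib, Finset.sum_sub_distrib, sum_edgeAt ha hb,
      sum_edgeAt hv ha, sum_edgeAt hv hb]
    omega
  obtain ⟨f, hf, hft⟩ := ih _ _ _ _ _ _ hadm hsm
  obtain ⟨s, hs, hf1⟩ := IsFlow.remove_edge
    (m := fun u w => m u w - edgeAt v a u w - edgeAt v b u w) hab ha hb
    (by simp only [h.symm a b, edgeAt_symm _ _ a b])
    (by have := h.nonneg a b; simp [edgeAt, hva.symm, hvb.symm, hab, hab.symm, this]) hf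
  have hs' : -s = 1 ∨ -s = -1 := by omega
  have hf2 := (hf1.add_edge (m := fun u w => m u w - edgeAt v a u w) hs hvb).add_edge hs' hva
  refine ⟨_, hf2, fun w hw => ?_⟩
  have e : ∑ u ∈ T, (f w u - s * arcAt a b w u + s * arcAt v b w u + -s * arcAt v a w u) =
      ∑ u ∈ T, f w u := by
    simp only [Finset.sum_add_distrib, Finset.sum_sub_distrib, ← Finset.mul_sum, sum_arcAt ha hb,
      sum_arcAt hv hb, sum_arcAt hv ha]
    ring
  rw [e]
  exact hft w hw

lemma hasFlow_of_lift_fixed (h : IsAdmissible k T x m c g τ) (ih : AllSmaller k T m c) {v a : V}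
    (hv : v ∈ T) (ha : a ∈ T) (hva : v ≠ a) (hma : 0 < m v a) (hc : 0 < c v)
    (H : ∀ A ⊆ T, A ≠ T → A.Nonempty → (∀ v, x = some v → A ≠ {v}) → v ∈ A →
      IsSlack k T m c τ A) : HasFlow k T m g τ := by
  obtain ⟨s, hs, hgs⟩ := exists_sign (h.fixed_le v hv) hc (h.fixed_even v hv)
  set m' : V → V → ℤ := fun u w => m u w - edgeAt v a u w with hm'
  set c' : V → ℤ := fun u => c u + (unitAt a u - unitAt v u) with hc'
  set g' : V → ℤ := fun u => g u + s * (unitAt a u - unitAt v u) with hg'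
  have hbd : ∀ A, boundary T m' c' A = boundary T m c A - (if (v ∈ A ↔ a ∈ A) then 0 else 1) +
      ((if a ∈ A then 1 else 0) - if v ∈ A then 1 else 0) := by
    intro A
    rw [hm', hc', boundary_fixed, boundary_sub_edgeAt m c hv ha]
    simp only [Finset.sum_sub_distrib, sum_unitAt]
  have hcs : ∑ u ∈ T, c' u = ∑ u ∈ T, c u := by
    simp [hc', Finset.sum_add_distrib, Finset.sum_sub_distrib, sum_unitAt, ha, hv]
  have hgs' : ∑ u ∈ T, g' u = ∑ u ∈ T, g u := by
    simp [hg', Finset.sum_add_distrib, Finset.sum_sub_distrib, ← Finset.mul_sum, sum_unitAt, ha, hv]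
  have hadm : IsAdmissible k T x m' c' g' τ := by
    refine ⟨fun u w => ?_, fun u w => ?_, fun u => ?_, fun u hu => ?_, fun u hu => ?_,
      fun u hu => ?_, by rw [hgs']; exact h.total, by rw [hgs', hcs]; exact h.root,
      fun A hA hAT hA0 hAx => ?_, h.exempt⟩
    · simp only [hm', h.symm u w, edgeAt_symm _ _ u w]
    · have h1 := h.nonneg u w
      have h3 := h.symm v a
      simp only [hm']
      rcases edgeAt_cases hva u w with ⟨rfl, rfl, e1, -⟩ | ⟨rfl, rfl, e1, -⟩ | ⟨e1, -⟩ <;> omega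
    · simp only [hm', h.diag, edgeAt_self hva]; rfl
    · have := h.fixed_le u hu
      simp only [hg', hc', unitAt]
      rw [abs_le] at this hgs ⊢
      rcases hs with rfl | rfl <;> split_ifs <;> subst_vars <;> omega
    · have := h.fixed_even u hu
      simp only [hg', hc', unitAt]
      rcases hs with rfl | rfl <;> split_ifs <;> omega
    · have := h.even u hu
      rw [hbd]
      split_ifs <;> first | omega | tauto
    · rw [hbd]
      by_cases hc : v ∈ A
      · obtain ⟨j, hj⟩ := H A hA hAT hA0 hAx hc
        exact ⟨j, by split_ifs <;> omega⟩
      · obtain ⟨j, hj⟩ := h.cut A hA hAT hA0 hAx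
        refine ⟨j, ?_⟩
        split_ifs <;> first | omega | tauto
  have hsm : Smaller T m' c' T m c := by
    refine Or.inr ⟨rfl, Or.inl ?_⟩
    simp only [hm', Finset.sum_sub_distrib, sum_edgeAt hv ha]
    omega
  obtain ⟨f, hf, hft⟩ := ih _ _ _ _ _ _ hadm hsm
  have hs' : -s = 1 ∨ -s = -1 := by omega
  refine ⟨_, hf.add_edge hs' hva, fun w hw => ?_⟩
  have e : ∑ u ∈ T, (f w u + -s * arcAt v a w u) + g w = ∑ u ∈ T, f w u + g' w := by
    simp only [Finset.sum_add_distrib, ← Finset.mul_sum, sum_arcAt hv ha, hg']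
    ring
  rw [e]
  exact hft w hw

lemma hasFlow_of_pendant (h : IsAdmissible k T x m c g τ) (ih : AllSmaller k T m c) {v a : V}
    (hk : 1 ≤ k) (hv : v ∈ T) (hc : c v = 0) (hm : ∀ u ∈ T, u ≠ a → m v u = 0)
    (hx : x = some v) : HasFlow k T m g τ := by
  have hg : g v = 0 := by have := h.fixed_le v hv; rw [hc] at this; simpa using this
  have hτ := h.exempt v hv hx
  have hrow : ∑ w ∈ T, m v w = if a ∈ T then m v a else 0 := by
    split_ifs with ha
    · exact Finset.sum_eq_single a (fun u hu hua => hm u hu hua) (by simp [ha])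
    · exact Finset.sum_eq_zero fun u hu => hm u hu (by rintro rfl; exact ha hu)
  have hev : ∀ u ∈ T, 2 ∣ m v u := by
    intro u hu
    by_cases hua : u = a
    · subst hua
      have h1 := h.even v hv
      rw [boundary_singleton c h.diag hv, hrow, if_pos hu, hc] at h1
      have : (2 : ℤ) ∣ τ v := (dvd_mul_right 2 k).trans hτ
      omega
    · rw [hm u hu hua]; simp
  have hsum : ∀ (F : V → ℤ), ∑ u ∈ T.erase v, F u = ∑ u ∈ T, F u - F v :=
    fun F => Finset.sum_erase_eq_sub hv
  have hadm : IsAdmissible k (T.erase v) none m c g τ := by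
    refine ⟨h.symm, h.nonneg, h.diag, fun u hu => h.fixed_le u (Finset.mem_of_mem_erase hu),
      fun u hu => h.fixed_even u (Finset.mem_of_mem_erase hu), fun u hu => ?_, ?_, fun j => ?_,
      fun A hA hAT hA0 _ => ?_, by simp⟩
    · have h1 := h.even u (Finset.mem_of_mem_erase hu)
      rw [boundary_singleton c h.diag (Finset.mem_of_mem_erase hu)] at h1
      rw [boundary_singleton c h.diag hu, hsum]
      have := hev u (Finset.mem_of_mem_erase hu)
      have h3 := h.symm u v
      omega
    · have h1 := h.total
      rw [hsum, hsum, hg]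
      have : ∑ u ∈ T, τ u - τ v - (∑ u ∈ T, g u - 0) = (∑ u ∈ T, τ u - ∑ u ∈ T, g u) - τ v := by
        ring
      rw [this]
      exact dvd_sub h1 hτ
    · rw [hsum, hsum, hc, hg, sub_zero, sub_zero]; exact h.root j
    · have hvA : v ∉ A := fun hvA => Finset.notMem_erase v T (hA hvA)
      have hAT' : A ⊆ T := hA.trans (Finset.erase_subset _ _)
      by_cases haA : a ∈ A
      · have hne : insert v A ≠ T := by
          intro he; apply hAT; rw [← he, Finset.erase_insert hvA]
        obtain ⟨j, hj⟩ := h.cut (insert v A) (Finset.insert_subset hv hAT') hne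
          (Finset.insert_nonempty _ _) (by
            rintro w hw he
            rw [hx] at hw; cases hw
            have : a ∈ ({v} : Finset V) := he ▸ Finset.mem_insert_of_mem haA
            rw [Finset.mem_singleton] at this; subst this; exact hvA haA)
        obtain ⟨i, hi⟩ := hτ
        refine ⟨j - i, ?_⟩
        have e1 : boundary T m c (insert v A) = boundary (T.erase v) m c A := by
          have e2 : T \ insert v A = T.erase v \ A := by ext u; simp; tauto
          have e3 : ∑ w ∈ T \ insert v A, m v w = 0 :=
            Finset.sum_eq_zero fun u hu => by
              simp only [Finset.mem_sdiff, Finset.mem_insert, not_or] at hu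
              exact hm u hu.1 (by rintro rfl; exact hu.2.2 haA)
          simp only [boundary, Finset.sum_insert hvA, e3, hc, ← e2]; ring
        rw [Finset.sum_insert hvA, hi, e1] at hj
        have e4 : 2 * k * i + ∑ u ∈ A, τ u - 2 * k * j = ∑ u ∈ A, τ u - 2 * k * (j - i) := by ring
        rwa [e4] at hj
      · have hne : A ≠ T := by rintro rfl; exact hvA hv
        obtain ⟨j, hj⟩ := h.cut A hAT' hne hA0 (by
            rintro w hw he
            rw [hx] at hw; cases hw
            exact hvA (by simp [he]))
        refine ⟨j, ?_⟩
        have e1 : boundary T m c A = boundary (T.erase v) m c A := by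
          have e2 : T.erase v \ A = (T \ A).erase v := by ext u; simp; tauto
          simp only [boundary]
          congr 1
          refine Finset.sum_congr rfl fun u hu => ?_
          rw [e2, Finset.sum_erase]
          rw [h.symm]; exact hm u (hAT' hu) (by rintro rfl; exact haA hu)
        rwa [e1] at hj
  have hcard : (T.erase v).card < T.card := Finset.card_erase_lt_of_mem hv
  obtain ⟨f, hf, hft⟩ := ih _ _ _ _ _ _ hadm (Or.inl hcard)
  refine ⟨fun u w => if u = v ∨ w = v then 0 else f u w, ⟨fun u w => ?_, fun u hu w hw => ?_,
    fun u hu w hw => ?_⟩, fun w hw => ?_⟩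
  · have := hf.antisymm u w
    simp only [or_comm]; split_ifs <;> simp [this]
  · split_ifs with h1
    · simpa using h.nonneg u w
    · exact hf.le u (by simp_all) w (by simp_all)
  · split_ifs with h1
    · rw [zero_add]
      rcases h1 with rfl | rfl
      · exact hev w hw
      · rw [h.symm]; exact hev u hu
    · exact hf.even u (by simp_all) w (by simp_all)
  · by_cases hwv : w = v
    · subst hwv
      simp [hg, hτ]; omega
    · have e : ∑ u ∈ T, (if w = v ∨ u = v then 0 else f w u) = ∑ u ∈ T.erase v, f w u := by
        rw [← Finset.sum_erase (a := v) (f := fun u => if w = v ∨ u = v then 0 else f w u) T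
          (by simp)]
        exact Finset.sum_congr rfl fun u hu => by simp_all
      rw [e]
      exact hft w (by simp_all)

lemma IsAdmissible.not_isolated (h : IsAdmissible k T x m c g τ) {v : V} (hv : v ∈ T)
    (hT : 2 ≤ T.card) (hm : ∀ u ∈ T, m v u = 0) (hx : ∀ w ∈ T, x = some w → w = v) :
    ¬ ∃ j, |τ v - 2 * k * j| + 1 ≤ c v := by
  rintro ⟨j, hj⟩
  have hvT : v ∉ T.erase v := Finset.notMem_erase v T
  have hne : (T.erase v).Nonempty := by
    rw [← Finset.card_pos, Finset.card_erase_of_mem hv]; omega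
  obtain ⟨i, hi⟩ := h.cut (T.erase v) (Finset.erase_subset _ _) (fun he => by rw [he] at hvT; exact hvT hv) hne (by
    rintro w hw he
    have hw' : w ∈ T.erase v := by simp [he]
    have := hx w (Finset.mem_of_mem_erase hw') hw
    subst this
    exact hvT hw')
  have e1 : boundary T m c (T.erase v) = ∑ u ∈ T, c u - c v := by
    have e2 : T \ T.erase v = {v} := by ext u; simp; grind
    have e3 : ∑ u ∈ T.erase v, m u v = 0 := Finset.sum_eq_zero fun u hu => by
      rw [h.symm]; exact hm u (Finset.mem_of_mem_erase hu)
    rw [boundary, e2, Finset.sum_erase_eq_sub (f := c) hv]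
    simp only [Finset.sum_singleton, e3]; ring
  rw [e1, Finset.sum_erase_eq_sub hv] at hi
  obtain ⟨l, hl⟩ := h.total
  have hr := h.root (i + j - l)
  have e4 : ∑ u ∈ T, g u - 2 * k * (i + j - l) =
    (∑ u ∈ T, τ u - τ v - 2 * k * i) + (τ v - 2 * k * j) := by linear_combination -hl
  rw [e4] at hr
  have := abs_add_le (∑ u ∈ T, τ u - τ v - 2 * k * i) (τ v - 2 * k * j)
  omega


/-- The sum of `F` over the fibre of `p` at `u`. -/
def fiberSum (T : Finset V) (p : V → V) (F : V → ℤ) (u : V) : ℤ := ∑ v ∈ T with p v = u, F v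

def contractEdges (T : Finset V) (p : V → V) (m : V → V → ℤ) (u w : V) : ℤ :=
  if u = w then 0 else ∑ v ∈ T with p v = u, ∑ v' ∈ T with p v' = w, m v v'

lemma sum_fiberSum (p : V → V) (F : V → ℤ) (B : Finset V) :
    ∑ u ∈ B, fiberSum T p F u = ∑ v ∈ T with p v ∈ B, F v := by
  rw [← Finset.sum_fiberwise_of_maps_to (s := T.filter (p · ∈ B)) (t := B) (g := p)
    (fun v hv => (Finset.mem_filter.1 hv).2)]
  refine Finset.sum_congr rfl fun u hu => ?_
  rw [fiberSum, Finset.filter_filter]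
  refine Finset.sum_congr ?_ fun _ _ => rfl
  ext v; simp only [Finset.mem_filter]; grind

lemma boundary_contract {p : V → V} {T' : Finset V} (hp : ∀ v ∈ T, p v ∈ T') (B : Finset V) :
    boundary T' (contractEdges T p m) (fiberSum T p c) B =
      boundary T m c (T.filter (p · ∈ B)) := by
  rw [boundary, boundary, sum_fiberSum]
  congr 1
  have h1 : T \ T.filter (p · ∈ B) = T.filter (p · ∈ T' \ B) := by
    ext v; simp only [Finset.mem_filter, Finset.mem_sdiff]; grind
  rw [h1]
  have h2 : ∀ u ∈ B, ∑ w ∈ T' \ B, contractEdges T p m u w =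
      fiberSum T p (fun v => ∑ v' ∈ T with p v' ∈ T' \ B, m v v') u := by
    intro u hu
    have h3 : ∀ w ∈ T' \ B, contractEdges T p m u w =
        ∑ v ∈ T with p v = u, fiberSum T p (m v) w := by
      intro w hw
      rw [contractEdges, if_neg]
      · rfl
      · rintro rfl; exact (Finset.mem_sdiff.1 hw).2 hu
    rw [Finset.sum_congr rfl h3, Finset.sum_comm, fiberSum]
    exact Finset.sum_congr rfl fun v _ => sum_fiberSum p (m v) _
  rw [Finset.sum_congr rfl h2, sum_fiberSum]

lemma IsAdmissible.contract (h : IsAdmissible k T x m c g τ) {p : V → V} {T' : Finset V}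
    (hp : ∀ v ∈ T, p v ∈ T') (hsurj : ∀ u ∈ T', ∃ v ∈ T, p v = u)
    (hcut : ∀ w ∈ T, x = some w → ∀ B ⊆ T', T.filter (p · ∈ B) = {w} → B = {w})
    (hex : ∀ w ∈ T', x = some w → T.filter (p · = w) = {w}) :
    IsAdmissible k T' x (contractEdges T p m) (fiberSum T p c) (fiberSum T p g)
      (fiberSum T p τ) := by
  have htot : ∀ F : V → ℤ, ∑ u ∈ T', fiberSum T p F u = ∑ v ∈ T, F v :=
    fun F => Finset.sum_fiberwise_of_maps_to hp F
  refine ⟨fun u w => ?_, fun u w => ?_, fun u => ?_, fun u hu => ?_, fun u hu => ?_,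
    fun u hu => ?_, by rw [htot, htot]; exact h.total, by rw [htot, htot]; exact h.root,
    fun B hB hBT hB0 hBx => ?_, fun u hu hux => ?_⟩
  · simp only [contractEdges, eq_comm (a := u)]
    split_ifs
    · rfl
    · rw [Finset.sum_comm]; simp only [h.symm]
  · rw [contractEdges]
    split_ifs
    · rfl
    · exact Finset.sum_nonneg fun v _ => Finset.sum_nonneg fun v' _ => h.nonneg v v'
  · simp [contractEdges]
  · exact (Finset.abs_sum_le_sum_abs _ _).trans
      (Finset.sum_le_sum fun v hv => h.fixed_le v (Finset.mem_filter.1 hv).1)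
  · rw [fiberSum, fiberSum, ← Finset.sum_add_distrib]
    exact Finset.dvd_sum fun v hv => h.fixed_even v (Finset.mem_filter.1 hv).1
  · rw [boundary_contract hp]
    have := two_dvd_sum_add_boundary h.symm h.diag h.even (Finset.filter_subset (p · ∈ ({u} : Finset V)) T)
    simpa only [Finset.mem_singleton, fiberSum] using this
  · rw [boundary_contract hp, sum_fiberSum]
    refine h.cut _ (Finset.filter_subset _ _) (fun he => ?_) ?_ (fun w hw he => ?_)
    · apply hBT
      refine Finset.Subset.antisymm hB fun u hu => ?_
      obtain ⟨v, hv, rfl⟩ := hsurj u hu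
      rw [← he] at hv
      exact (Finset.mem_filter.1 hv).2
    · obtain ⟨u, hu⟩ := hB0
      obtain ⟨v, hv, rfl⟩ := hsurj u (hB hu)
      exact ⟨v, Finset.mem_filter.2 ⟨hv, hu⟩⟩
    · have hwT : w ∈ T := by
        have : w ∈ T.filter (p · ∈ B) := by simp [he]
        exact (Finset.mem_filter.1 this).1
      exact hBx w hw (hcut w hwT hw B hB he)
  · rw [fiberSum, hex u hu hux, Finset.sum_singleton]
    refine h.exempt u ?_ hux
    have : u ∈ T.filter (p · = u) := by simp [hex u hu hux]
    exact (Finset.mem_filter.1 this).1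

lemma exists_split {ι : Type*} [DecidableEq ι] (A : Finset ι) (M : ι → ℤ) (hM : ∀ i ∈ A, 0 ≤ M i) (F : ℤ)
    (hF : |F| ≤ ∑ i ∈ A, M i) (h2 : 2 ∣ F + ∑ i ∈ A, M i) :
    ∃ h : ι → ℤ, (∀ i ∈ A, |h i| ≤ M i) ∧ (∀ i ∈ A, 2 ∣ h i + M i) ∧ ∑ i ∈ A, h i = F := by
  induction A using Finset.induction_on generalizing F with
  | empty =>
    simp only [Finset.sum_empty] at hF
    exact ⟨0, by simp, by simp, by simp; symm; simpa using hF⟩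
  | insert a A ha ih =>
    rw [Finset.sum_insert ha] at hF h2
    have hS : 0 ≤ ∑ i ∈ A, M i := Finset.sum_nonneg fun i hi => hM i (Finset.mem_insert_of_mem hi)
    have hMa := hM a (Finset.mem_insert_self _ _)
    have key : ∃ y, |y| ≤ M a ∧ 2 ∣ y + M a ∧ |F - y| ≤ ∑ i ∈ A, M i := by
      simp only [abs_le] at hF ⊢
      by_cases h1 : F + M a ≤ ∑ i ∈ A, M i
      · exact ⟨-M a, by omega⟩
      · exact ⟨F - ∑ i ∈ A, M i, by omega⟩
    obtain ⟨y, hy1, hy2, hy3⟩ := key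
    obtain ⟨h, hh1, hh2, hh3⟩ := ih (fun i hi => hM i (Finset.mem_insert_of_mem hi)) (F - y) hy3
      (by omega)
    have hne : ∀ i ∈ A, i ≠ a := by rintro i hi rfl; exact ha hi
    refine ⟨Function.update h a y, ?_, ?_, ?_⟩
    · intro i hi
      rcases Finset.mem_insert.1 hi with rfl | hi
      · simpa using hy1
      · simpa [Function.update_of_ne (hne i hi)] using hh1 i hi
    · intro i hi
      rcases Finset.mem_insert.1 hi with rfl | hi
      · simpa using hy2
      · simpa [Function.update_of_ne (hne i hi)] using hh2 i hi
    · rw [Finset.sum_insert ha, Function.update_self, Finset.sum_congr rfl fun i hi =>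
        Function.update_of_ne (hne i hi) y h, hh3]
      ring

/-- Fixing the edges between `A` and its complement according to `e` yields an instance on `A`. -/
lemma IsAdmissible.inner (h : IsAdmissible k T x m c g τ) {A : Finset V} (hA : A ⊆ T)
    (hAT : A ≠ T) (hns : ¬ IsSlack k T m c τ A) (e : V → V → ℤ)
    (he1 : ∀ v ∈ A, ∀ u ∈ T \ A, |e v u| ≤ m v u) (he2 : ∀ v ∈ A, ∀ u ∈ T \ A, 2 ∣ e v u + m v u)
    (he3 : 2 * k ∣ ∑ v ∈ A, τ v - ∑ v ∈ A, (g v + ∑ u ∈ T \ A, e v u)) :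
    IsAdmissible k A x m (fun v => c v + ∑ u ∈ T \ A, m v u) (fun v => g v + ∑ u ∈ T \ A, e v u)
      τ := by
  have hbd : ∀ B ⊆ A, boundary A m (fun v => c v + ∑ u ∈ T \ A, m v u) B = boundary T m c B := by
    intro B hB
    have h1 : ∀ u ∈ B, ∑ v ∈ T \ B, m u v = ∑ v ∈ A \ B, m u v + ∑ v ∈ T \ A, m u v := by
      intro u _
      rw [← Finset.sum_sdiff (Finset.sdiff_subset_sdiff hA (Finset.Subset.refl B)), add_comm]
      congr 1
      refine Finset.sum_congr ?_ fun _ _ => rfl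
      ext v; simp only [Finset.mem_sdiff]; grind
    rw [boundary, boundary, Finset.sum_congr rfl h1]
    simp only [Finset.sum_add_distrib]; ring
  refine ⟨h.symm, h.nonneg, h.diag, fun v hv => ?_, fun v hv => ?_, fun v hv => ?_, he3,
    fun j => ?_, fun B hB hBA hB0 hBx => ?_, fun v hv => h.exempt v (hA hv)⟩
  · refine (abs_add_le _ _).trans (add_le_add (h.fixed_le v (hA hv)) ?_)
    exact (Finset.abs_sum_le_sum_abs _ _).trans (Finset.sum_le_sum fun u hu => he1 v hv u hu)
  · have h1 := h.fixed_even v (hA hv)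
    have h2 : 2 ∣ ∑ u ∈ T \ A, (e v u + m v u) := Finset.dvd_sum fun u hu => he2 v hv u hu
    rw [Finset.sum_add_distrib] at h2
    omega
  · rw [hbd _ (Finset.singleton_subset_iff.2 hv)]; exact h.even v (hA hv)
  · obtain ⟨i, hi⟩ := he3
    have h1 := h.le_of_not_isSlack hA hns (i + j)
    have h2 : ∑ v ∈ A, (c v + ∑ u ∈ T \ A, m v u) = boundary T m c A := by
      rw [boundary, Finset.sum_add_distrib, add_comm]
    have h3 : ∑ v ∈ A, (g v + ∑ u ∈ T \ A, e v u) - 2 * k * j =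
      ∑ v ∈ A, τ v - 2 * k * (i + j) := by linear_combination -hi
    rw [h2, h3]; exact h1
  · rw [hbd B hB]
    exact h.cut B (hB.trans hA) (fun h' => hAT (Finset.Subset.antisymm hA (h' ▸ hB))) hB0 hBx

lemma hasFlow_of_contract (h : IsAdmissible k T x m c g τ) (ih : AllSmaller k T m c) {A : Finset V}
    (hA : A ⊆ T) (hAT : A ≠ T) (hA2 : 2 ≤ A.card) (hns : ¬ IsSlack k T m c τ A) :
    HasFlow k T m g τ := by
  obtain ⟨a, ha, hxa⟩ : ∃ a ∈ A, x ≠ some a := by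
    obtain ⟨a, ha, b, hb, hab⟩ := Finset.one_lt_card.1 hA2
    by_cases hxa : x = some a
    · exact ⟨b, hb, by rw [hxa]; simpa using hab⟩
    · exact ⟨a, ha, hxa⟩
  set p : V → V := fun v => if v ∈ A then a else v with hp
  set T' := insert a (T \ A) with hT'
  have hpA : ∀ v ∈ A, p v = a := fun v hv => if_pos hv
  have hpT : ∀ v, v ∉ A → p v = v := fun v hv => if_neg hv
  have hfa : T.filter (p · = a) = A := by
    ext v
    simp only [Finset.mem_filter]
    by_cases hv : v ∈ A
    · simp [hv, hpA v hv, hA hv]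
    · simp only [hpT v hv, hv, iff_false]; rintro ⟨-, rfl⟩; exact hv ha
  have hfu : ∀ u ∈ T \ A, T.filter (p · = u) = {u} := by
    intro u hu
    rw [Finset.mem_sdiff] at hu
    ext v
    simp only [Finset.mem_filter, Finset.mem_singleton]
    by_cases hv : v ∈ A
    · rw [hpA v hv]
      constructor
      · rintro ⟨-, rfl⟩; exact absurd ha hu.2
      · rintro rfl; exact absurd hv hu.2
    · rw [hpT v hv]
      exact ⟨fun h => h.2, by rintro rfl; exact ⟨hu.1, rfl⟩⟩
  have hadm := h.contract (p := p) (T' := T')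
    (fun v hv => by
      by_cases hvA : v ∈ A
      · simp [hpA v hvA, hT']
      · simp [hpT v hvA, hT', hv, hvA])
    (fun u hu => by
      rcases Finset.mem_insert.1 hu with rfl | hu
      · exact ⟨u, hA ha, hpA u ha⟩
      · rw [Finset.mem_sdiff] at hu
        exact ⟨u, hu.1, hpT u hu.2⟩)
    (fun w hw hxw B hB he => by
      by_cases haB : a ∈ B
      · exfalso
        have h1 : A ⊆ {w} := by
          rw [← he]; intro v hv
          exact Finset.mem_filter.2 ⟨hA hv, by rw [hpA v hv]; exact haB⟩
        have := Finset.card_le_card h1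
        simp at this; omega
      · rw [← he]
        ext v
        have hwA : w ∉ A := by
          intro hwA
          have : w ∈ T.filter (p · ∈ B) := by simp [he]
          rw [Finset.mem_filter, hpA w hwA] at this
          exact haB this.2
        constructor
        · intro hv
          rcases Finset.mem_insert.1 (hB hv) with rfl | hv'
          · exact absurd hv haB
          · rw [Finset.mem_sdiff] at hv'
            exact Finset.mem_filter.2 ⟨hv'.1, by rw [hpT v hv'.2]; exact hv⟩
        · intro hv
          have hv' : v = w := by rw [he] at hv; simpa using hv
          subst hv'
          have := (Finset.mem_filter.1 hv).2
          rwa [hpT v hwA] at this)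
    (fun w hw hxw => by
      rcases Finset.mem_insert.1 hw with rfl | hw
      · exact absurd hxw hxa
      · exact hfu w hw)
  have haT : a ∉ T \ A := by simp [ha]
  have hcard : T'.card < T.card := by
    rw [hT', Finset.card_insert_of_notMem haT, Finset.card_sdiff_of_subset hA]
    have := Finset.card_le_card hA
    omega
  have hcard' : A.card < T.card :=
    Finset.card_lt_card ((Finset.ssubset_iff_subset_ne).2 ⟨hA, hAT⟩)
  obtain ⟨f, hf, hft⟩ := ih _ _ _ _ _ _ hadm (Or.inl hcard)
  have haT' : a ∈ T' := Finset.mem_insert_self _ _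
  have hmem : ∀ u ∈ T \ A, u ∈ T' := fun u hu => Finset.mem_insert_of_mem hu
  have hne : ∀ u ∈ T \ A, u ≠ a := by rintro u hu rfl; exact haT hu
  have hca : ∀ u ∈ T \ A, contractEdges T p m u a = ∑ v ∈ A, m u v := by
    intro u hu
    rw [contractEdges, if_neg (hne u hu), hfu u hu, hfa, Finset.sum_singleton]
  have hcu : ∀ u ∈ T \ A, ∀ w ∈ T \ A, contractEdges T p m u w = m u w := by
    intro u hu w hw
    rw [contractEdges]
    split_ifs with huw
    · rw [huw, h.diag]
    · rw [hfu u hu, hfu w hw, Finset.sum_singleton, Finset.sum_singleton]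
  have hsplit : ∀ u, ∃ e : V → ℤ, u ∈ T \ A → (∀ v ∈ A, |e v| ≤ m u v) ∧
      (∀ v ∈ A, 2 ∣ e v + m u v) ∧ ∑ v ∈ A, e v = f u a := by
    intro u
    by_cases hu : u ∈ T \ A
    · obtain ⟨e, he⟩ := exists_split A (m u) (fun v _ => h.nonneg u v) (f u a)
        (by rw [← hca u hu]; exact hf.le u (hmem u hu) a haT')
        (by rw [← hca u hu]; exact hf.even u (hmem u hu) a haT')
      exact ⟨e, fun _ => he⟩
    · exact ⟨0, fun hu' => absurd hu' hu⟩
  choose e he using hsplit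
  have hsum : ∑ v ∈ A, (g v + ∑ u ∈ T \ A, -e u v) = ∑ u ∈ T', f a u + fiberSum T p g a := by
    rw [Finset.sum_add_distrib, Finset.sum_comm, fiberSum, hfa, hT', Finset.sum_insert haT]
    have h0 : f a a = 0 := by have := hf.antisymm a a; omega
    have h1 : ∀ u ∈ T \ A, ∑ v ∈ A, -e u v = f a u := by
      intro u hu
      rw [Finset.sum_neg_distrib, (he u hu).2.2, hf.antisymm a u]
    rw [Finset.sum_congr rfl h1, h0]; ring
  have hinner := h.inner hA hAT hns (fun v u => -e u v)
    (fun v hv u hu => by rw [abs_neg, h.symm]; exact (he u hu).1 v hv)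
    (fun v hv u hu => by have := (he u hu).2.1 v hv; have := h.symm u v; omega)
    (by
      rw [hsum, ← dvd_neg, neg_sub]
      have := (hft a haT').1
      rwa [show fiberSum T p τ a = ∑ v ∈ A, τ v by rw [fiberSum, hfa]] at this)
  obtain ⟨f', hf', hft'⟩ := ih _ _ _ _ _ _ hinner (Or.inl hcard')
  refine ⟨fun u v => if u ∈ A then (if v ∈ A then f' u v else -e v u) else
      (if v ∈ A then e u v else f u v), ⟨fun u v => ?_, fun u hu v hv => ?_, fun u hu v hv => ?_⟩,
      fun v hv => ?_⟩
  · have := hf.antisymm u v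
    have := hf'.antisymm u v
    split_ifs <;> simp [*]
  · split_ifs with h1 h2 h2
    · exact hf'.le u h1 v h2
    · rw [abs_neg, h.symm]; exact (he v (Finset.mem_sdiff.2 ⟨hv, h2⟩)).1 u h1
    · exact (he u (Finset.mem_sdiff.2 ⟨hu, h1⟩)).1 v h2
    · have hu' := Finset.mem_sdiff.2 ⟨hu, h1⟩
      have hv' := Finset.mem_sdiff.2 ⟨hv, h2⟩
      rw [← hcu u hu' v hv']
      exact hf.le u (hmem u hu') v (hmem v hv')
  · split_ifs with h1 h2 h2
    · exact hf'.even u h1 v h2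
    · have := (he v (Finset.mem_sdiff.2 ⟨hv, h2⟩)).2.1 u h1
      have := h.symm u v
      omega
    · exact (he u (Finset.mem_sdiff.2 ⟨hu, h1⟩)).2.1 v h2
    · have hu' := Finset.mem_sdiff.2 ⟨hu, h1⟩
      have hv' := Finset.mem_sdiff.2 ⟨hv, h2⟩
      rw [← hcu u hu' v hv']
      exact hf.even u (hmem u hu') v (hmem v hv')
  · rw [← Finset.sum_sdiff hA]
    by_cases hvA : v ∈ A
    · simp only [hvA, if_true]
      have h1 : ∑ u ∈ T \ A, (if u ∈ A then f' v u else -e u v) = ∑ u ∈ T \ A, -e u v :=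
        Finset.sum_congr rfl fun u hu => if_neg (Finset.mem_sdiff.1 hu).2
      have h2 : ∑ u ∈ A, (if u ∈ A then f' v u else -e u v) = ∑ u ∈ A, f' v u :=
        Finset.sum_congr rfl fun u hu => if_pos hu
      rw [h1, h2]
      have := hft' v hvA
      have h3 : ∑ u ∈ T \ A, -e u v + ∑ u ∈ A, f' v u + g v =
        ∑ u ∈ A, f' v u + (g v + ∑ u ∈ T \ A, -e u v) := by ring
      rw [h3]; exact this
    · simp only [hvA, if_false]
      have hv' := Finset.mem_sdiff.2 ⟨hv, hvA⟩
      have h1 : ∑ u ∈ T \ A, (if u ∈ A then e v u else f v u) = ∑ u ∈ T \ A, f v u :=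
        Finset.sum_congr rfl fun u hu => if_neg (Finset.mem_sdiff.1 hu).2
      have h2 : ∑ u ∈ A, (if u ∈ A then e v u else f v u) = f v a := by
        rw [← (he v hv').2.2]; exact Finset.sum_congr rfl fun u hu => if_pos hu
      rw [h1, h2]
      have := hft v (hmem v hv')
      rw [hT', Finset.sum_insert haT, fiberSum, fiberSum, hfu v hv', Finset.sum_singleton,
        Finset.sum_singleton] at this
      rwa [add_comm (∑ u ∈ T \ A, f v u)]


lemma IsAdmissible.exists_boundary_le (h : IsAdmissible k T none m c g τ) (hk : 1 ≤ k)
    {A : Finset V} (hA : A ⊆ T) (hA0 : A.Nonempty) :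
    ∃ j, |∑ v ∈ A, τ v - 2 * k * j| ≤ boundary T m c A := by
  by_cases hAT : A = T
  · subst hAT
    obtain ⟨j, hj⟩ := h.total
    refine ⟨j, ?_⟩
    have : ∑ v ∈ A, τ v - 2 * k * j = ∑ v ∈ A, g v := by linear_combination hj
    rw [this, boundary, Finset.sdiff_self]
    simp only [Finset.sum_empty, Finset.sum_const_zero, zero_add]
    exact (Finset.abs_sum_le_sum_abs _ _).trans (Finset.sum_le_sum fun v hv => h.fixed_le v hv)
  · obtain ⟨j, hj⟩ := h.cut A hA hAT hA0 (by simp)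
    exact ⟨j, by omega⟩

lemma hasFlow_of_slack_pendant (h : IsAdmissible k T none m c g τ) (ih : AllSmaller k T m c)
    {v a : V} (hk : 1 ≤ k) (hv : v ∈ T) (ha : a ∈ T) (hva : v ≠ a) (hc : c v = 0)
    (hm : ∀ u ∈ T, u ≠ a → m v u = 0) (hs : IsSlack k T m c τ {v})
    (H : ∀ A ⊆ T, A ≠ T → 2 ≤ A.card → IsSlack k T m c τ A) : HasFlow k T m g τ := by
  have hbv : boundary T m c {v} = m v a := by
    rw [boundary_singleton c h.diag hv, hc, add_zero]
    exact Finset.sum_eq_single a (fun u hu hua => hm u hu hua) (fun h => absurd ha h)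
  have hsa : IsSlack k T m c τ {a} := by
    obtain ⟨j, hj⟩ := h.exists_boundary_le hk (A := {v, a})
      (by simp [Finset.insert_subset_iff, hv, ha]) (by simp)
    obtain ⟨i, hi⟩ := hs
    refine ⟨j - i, ?_⟩
    have hb : boundary T m c {v, a} + m v a = boundary T m c {a} := by
      have h1 := boundary_add_sum (A := {v, a}) (T := T)
        (by simp [Finset.insert_subset_iff, hv, ha]) m c
      have h2 := boundary_singleton c h.diag ha
      have h3 := boundary_singleton c h.diag hv
      rw [Finset.sum_pair hva, Finset.sum_pair hva, Finset.sum_pair hva, Finset.sum_pair hva,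
        Finset.sum_pair hva, h.diag, h.diag, h.symm a v] at h1
      omega
    rw [Finset.sum_pair hva] at hj
    simp only [Finset.sum_singleton] at hi ⊢
    have e : τ a - 2 * k * (j - i) = (τ v + τ a - 2 * k * j) - (τ v - 2 * k * i) := by ring
    have := abs_sub (τ v + τ a - 2 * k * j) (τ v - 2 * k * i)
    rw [e]
    omega
  have hmva : 2 ≤ m v a := by
    obtain ⟨i, hi⟩ := hs
    have := abs_nonneg (∑ v ∈ {v}, τ v - 2 * k * i)
    omega
  set m' : V → V → ℤ := fun u w => m u w - edgeAt v a u w - edgeAt v a u w with hm'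
  have hbd : ∀ A, boundary T m' c A = boundary T m c A - (if (v ∈ A ↔ a ∈ A) then 0 else 1) -
      (if (v ∈ A ↔ a ∈ A) then 0 else 1) := by
    intro A
    rw [hm', boundary_sub_edgeAt (fun u w => m u w - edgeAt v a u w) c hv ha,
      boundary_sub_edgeAt m c hv ha]
  have hadm : IsAdmissible k T none m' c g τ := by
    refine ⟨fun u w => ?_, fun u w => ?_, fun u => ?_, h.fixed_le, h.fixed_even, fun u hu => ?_,
      h.total, h.root, fun A hA hAT hA0 hAx => ?_, h.exempt⟩
    · simp only [hm', h.symm u w, edgeAt_symm _ _ u w]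
    · have h1 := h.nonneg u w
      have h3 := h.symm v a
      simp only [hm']
      rcases edgeAt_cases hva u w with ⟨rfl, rfl, e1, -⟩ | ⟨rfl, rfl, e1, -⟩ | ⟨e1, -⟩ <;> omega
    · simp only [hm', h.diag, edgeAt_self hva]; rfl
    · have := h.even u hu
      rw [hbd]
      split_ifs <;> omega
    · rw [hbd]
      by_cases hvaA : (v ∈ A ↔ a ∈ A)
      · simpa [hvaA] using h.cut A hA hAT hA0 hAx
      · have : IsSlack k T m c τ A := by
          by_cases h2 : 2 ≤ A.card
          · exact H A hA hAT h2
          · have h1 : A.card = 1 := by have := Finset.card_pos.2 hA0; omega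
            obtain ⟨w, rfl⟩ := Finset.card_eq_one.1 h1
            simp only [Finset.mem_singleton] at hvaA
            by_cases hw : v = w
            · rwa [← hw]
            · have : a = w := by tauto
              rwa [← this]
        obtain ⟨j, hj⟩ := this
        exact ⟨j, by rw [if_neg hvaA]; omega⟩
  have hsm : Smaller T m' c T m c := by
    refine Or.inr ⟨rfl, Or.inl ?_⟩
    simp only [hm', Finset.sum_sub_distrib, sum_edgeAt hv ha]
    omega
  obtain ⟨f, hf, hft⟩ := ih _ _ _ _ _ _ hadm hsm
  refine ⟨f, ⟨hf.antisymm, fun u hu w hw => (hf.le u hu w hw).trans ?_, fun u hu w hw => ?_⟩, hft⟩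
  · have := edgeAt_nonneg v a u w
    simp only [hm']; omega
  · have := hf.even u hu w hw
    simp only [hm'] at this; omega

lemma hasFlow_of_split (h : IsAdmissible k T x m c g τ) (ih : AllSmaller k T m c) {v : V}
    (hk : 1 ≤ k) (hT : 2 ≤ T.card) (hv : v ∈ T)
    (hx : x = some v ∨ x = none ∧ IsSlack k T m c τ {v})
    (H : ∀ A ⊆ T, A ≠ T → 2 ≤ A.card → IsSlack k T m c τ A) : HasFlow k T m g τ := by
  have H' : ∀ A ⊆ T, A ≠ T → A.Nonempty → (∀ w, x = some w → A ≠ {w}) →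
      (v ∈ A ∨ 2 ≤ A.card) → IsSlack k T m c τ A := by
    intro A hA hAT hA0 hAx hvA
    by_cases h2 : 2 ≤ A.card
    · exact H A hA hAT h2
    · have h1 : A.card = 1 := by have := Finset.card_pos.2 hA0; omega
      obtain ⟨w, rfl⟩ := Finset.card_eq_one.1 h1
      have : v = w := by simpa [h2] using hvA
      subst this
      rcases hx with hx | ⟨-, hx⟩
      · exact absurd rfl (hAx v hx)
      · exact hx
  have hne : ∀ {a}, 0 < m v a → v ≠ a := by
    rintro a h1 rfl; rw [h.diag] at h1; exact lt_irrefl _ h1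
  by_cases hab : ∃ a ∈ T, ∃ b ∈ T, a ≠ b ∧ 0 < m v a ∧ 0 < m v b
  · obtain ⟨a, ha, b, hb, hab, hma, hmb⟩ := hab
    exact hasFlow_of_lift h ih hv ha hb (hne hma) (hne hmb) hab hma hmb H'
  by_cases ha : ∃ a ∈ T, 0 < m v a
  · obtain ⟨a, ha, hma⟩ := ha
    rcases (h.fixed_nonneg hv).lt_or_eq with hc | hc
    · exact hasFlow_of_lift_fixed h ih hv ha (hne hma) hma hc
        fun A hA hAT hA0 hAx hvA => H' A hA hAT hA0 hAx (Or.inl hvA)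
    · have hm : ∀ u ∈ T, u ≠ a → m v u = 0 := by
        intro u hu hua
        by_contra hmu
        exact hab ⟨u, hu, a, ha, hua, lt_of_le_of_ne (h.nonneg v u) (Ne.symm hmu), hma⟩
      rcases hx with hx | ⟨rfl, hs⟩
      · exact hasFlow_of_pendant h ih hk hv hc.symm hm hx
      · exact hasFlow_of_slack_pendant h ih hk hv ha (hne hma) hc.symm hm hs H
  · have hm : ∀ u ∈ T, m v u = 0 := by
      intro u hu
      by_contra hmu
      exact ha ⟨u, hu, lt_of_le_of_ne (h.nonneg v u) (Ne.symm hmu)⟩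
    have hni := h.not_isolated hv hT hm (by
      rintro w - hw
      rcases hx with hx | ⟨hx, -⟩ <;> rw [hx] at hw <;> simp_all)
    rcases hx with hx | ⟨rfl, j, hj⟩
    · rcases (h.fixed_nonneg hv).lt_or_eq with hc | hc
      · obtain ⟨j, hj⟩ := h.exempt v hv hx
        exact absurd ⟨j, by rw [hj, sub_self, abs_zero]; omega⟩ hni
      · exact hasFlow_of_pendant h ih hk hv hc.symm (a := v) (fun u hu _ => hm u hu) hx
    · rw [boundary_singleton c h.diag hv, Finset.sum_eq_zero hm, Finset.sum_singleton] at hj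
      exact absurd ⟨j, by omega⟩ hni

/-- All vertices have exactly the required boundary size, and their demands are nonzero. -/
def IsTight (k : ℤ) (T : Finset V) (m : V → V → ℤ) (c τ : V → ℤ) : Prop :=
  ∀ v ∈ T, |τ v| ≤ k ∧ τ v ≠ 0 ∧ boundary T m c {v} = 2 * k - 2 + |τ v|

lemma IsAdmissible.hasFlow_of_tight (h : IsAdmissible k T x m c g τ) (hk : 1 ≤ k)
    (ht : IsTight k T m c τ) {f : V → V → ℤ} (hf : IsFlow T m f)
    (hft : ∀ v ∈ T, 2 * k ∣ ∑ u ∈ T, f v u + g v - τ v) : HasFlow k T m g τ := by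
  refine ⟨f, hf, fun v hv => ⟨hft v hv, ?_⟩⟩
  obtain ⟨h1, h2, h3⟩ := ht v hv
  obtain ⟨j, hj⟩ := hft v hv
  have h4 : |∑ u ∈ T, f v u + g v| ≤ 2 * k - 2 + |τ v| := by
    rw [← h3, boundary_singleton c h.diag hv]
    refine (abs_add_le _ _).trans (add_le_add ?_ (h.fixed_le v hv))
    exact (Finset.abs_sum_le_sum_abs _ _).trans (Finset.sum_le_sum fun u hu => hf.le v hv u hu)
  have h5 : ∑ u ∈ T, f v u + g v = τ v + 2 * k * j := by linear_combination hj
  rw [h5] at h4 ⊢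
  rcases lt_trichotomy j 0 with hj0 | rfl | hj0
  · have h6 : 2 * k * j ≤ - (2 * k) := by nlinarith
    rcases (show j ≤ -2 ∨ j = -1 by omega) with hj | rfl
    · have h7 : 2 * k * j ≤ - (4 * k) := by nlinarith
      generalize 2 * k * j = y at *
      grind
    · grind
  · grind
  · have h6 : 2 * k ≤ 2 * k * j := by nlinarith
    rcases (show 2 ≤ j ∨ j = 1 by omega) with hj | rfl
    · have h7 : 4 * k ≤ 2 * k * j := by nlinarith
      generalize 2 * k * j = y at *
      grind
    · grind

lemma exists_shift_sub_one {k t : ℤ} (h : 0 < t ∨ |t| = k) (hk : 1 ≤ k) :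
    ∃ j : ℤ, |t - 1 - 2 * k * j| ≤ |t| - 1 := by
  by_cases h0 : 0 < t
  · exact ⟨0, by grind⟩
  · exact ⟨-1, by grind⟩

lemma exists_shift_add_one {k t : ℤ} (h : t < 0 ∨ |t| = k) (hk : 1 ≤ k) :
    ∃ j : ℤ, |t + 1 - 2 * k * j| ≤ |t| - 1 := by
  by_cases h0 : t < 0
  · exact ⟨0, by grind⟩
  · exact ⟨1, by grind⟩

lemma hasFlow_of_delete (h : IsAdmissible k T none m c g τ) (ih : AllSmaller k T m c) {u v : V}
    (hk : 1 ≤ k) (hu : u ∈ T) (hv : v ∈ T) (hm : 0 < m u v)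
    (H : ∀ A ⊆ T, A ≠ T → 2 ≤ A.card → IsSlack k T m c τ A) (ht : IsTight k T m c τ)
    (hpos : 0 < τ u ∨ |τ u| = k) (hneg : τ v < 0 ∨ |τ v| = k) : HasFlow k T m g τ := by
  have huv : u ≠ v := by rintro rfl; rw [h.diag] at hm; exact lt_irrefl _ hm
  set m' : V → V → ℤ := fun a b => m a b - edgeAt u v a b with hm'
  set τ' : V → ℤ := fun w => τ w + (unitAt v w - unitAt u w) with hτ'
  have hbd : ∀ A, boundary T m' c A = boundary T m c A - (if (u ∈ A ↔ v ∈ A) then 0 else 1) :=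
    fun A => boundary_sub_edgeAt m c hu hv
  have hsum : ∀ A : Finset V, ∑ w ∈ A, τ' w =
      ∑ w ∈ A, τ w + ((if v ∈ A then 1 else 0) - if u ∈ A then 1 else 0) := by
    intro A
    simp only [hτ', Finset.sum_add_distrib, Finset.sum_sub_distrib, sum_unitAt]
  have hadm : IsAdmissible k T none m' c g τ' := by
    refine ⟨fun a b => ?_, fun a b => ?_, fun a => ?_, h.fixed_le, h.fixed_even, fun w hw => ?_,
      by rw [hsum, if_pos hu, if_pos hv, sub_self, add_zero]; exact h.total, h.root,
      fun A hA hAT hA0 _ => ?_, by simp⟩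
    · simp only [hm', h.symm a b, edgeAt_symm _ _ a b]
    · have h1 := h.nonneg a b
      have h3 := h.symm u v
      simp only [hm']
      rcases edgeAt_cases huv a b with ⟨rfl, rfl, e1, -⟩ | ⟨rfl, rfl, e1, -⟩ | ⟨e1, -⟩ <;> omega
    · simp only [hm', h.diag, edgeAt_self huv]; rfl
    · have := h.even w hw
      rw [hbd]
      simp only [hτ', unitAt, Finset.mem_singleton, eq_comm (a := w)]
      by_cases h1 : u = w <;> by_cases h2 : v = w <;> simp [h1, h2] <;> omega
    · rw [hbd, hsum]
      by_cases huvA : (u ∈ A ↔ v ∈ A)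
      · simpa [huvA] using h.cut A hA hAT hA0 (by simp)
      rw [if_neg huvA]
      by_cases h2 : 2 ≤ A.card
      · obtain ⟨j, hj⟩ := H A hA hAT h2
        refine ⟨j, ?_⟩
        simp only [abs_eq_max_neg] at hj ⊢
        generalize 2 * k * j = y at *
        split_ifs <;> omega
      · have h1 : A.card = 1 := by have := Finset.card_pos.2 hA0; omega
        obtain ⟨w, rfl⟩ := Finset.card_eq_one.1 h1
        simp only [Finset.mem_singleton] at huvA ⊢
        by_cases hw : u = w
        · subst hw
          obtain ⟨j, hj⟩ := exists_shift_sub_one hpos hk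
          refine ⟨j, ?_⟩
          rw [(ht u hu).2.2, if_neg huv.symm, if_pos rfl, Finset.sum_singleton]
          have e : τ u + (0 - 1) - 2 * k * j = τ u - 1 - 2 * k * j := by ring
          rw [e]; omega
        · have : v = w := by tauto
          subst this
          obtain ⟨j, hj⟩ := exists_shift_add_one hneg hk
          refine ⟨j, ?_⟩
          rw [(ht v hv).2.2, if_neg huv, if_pos rfl, Finset.sum_singleton]
          have e : τ v + (1 - 0) - 2 * k * j = τ v + 1 - 2 * k * j := by ring
          rw [e]; omega
  have hsm : Smaller T m' c T m c := by
    refine Or.inr ⟨rfl, Or.inl ?_⟩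
    simp only [hm', Finset.sum_sub_distrib, sum_edgeAt hu hv]
    omega
  obtain ⟨f, hf, hft⟩ := ih _ _ _ _ _ _ hadm hsm
  refine h.hasFlow_of_tight hk ht (hf.add_edge (Or.inl rfl) huv) fun w hw => ?_
  have e : ∑ b ∈ T, (f w b + 1 * arcAt u v w b) + g w - τ w = ∑ b ∈ T, f w b + g w - τ' w := by
    simp only [Finset.sum_add_distrib, ← Finset.mul_sum, sum_arcAt hu hv, hτ']
    ring
  rw [e]
  exact (hft w hw).1

lemma hasFlow_of_delete_fixed (h : IsAdmissible k T none m c g τ) (ih : AllSmaller k T m c) {v : V}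
    (hk : 1 ≤ k) (hv : v ∈ T) (hg : -c v < g v)
    (H : ∀ A ⊆ T, A ≠ T → 2 ≤ A.card → IsSlack k T m c τ A) (ht : IsTight k T m c τ)
    (hpos : 0 < τ v ∨ |τ v| = k) : HasFlow k T m g τ := by
  set c' : V → ℤ := fun w => c w + -unitAt v w with hc'
  set g' : V → ℤ := fun w => g w + -unitAt v w with hg'
  set τ' : V → ℤ := fun w => τ w + -unitAt v w with hτ'
  have hsum : ∀ (F : V → ℤ) (A : Finset V), ∑ w ∈ A, (F w + -unitAt v w) =
      ∑ w ∈ A, F w - if v ∈ A then 1 else 0 := by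
    intro F A
    rw [Finset.sum_add_distrib, Finset.sum_neg_distrib, sum_unitAt]; ring
  have hbd : ∀ A, boundary T m c' A = boundary T m c A - if v ∈ A then 1 else 0 := by
    intro A
    rw [hc', boundary_fixed, Finset.sum_neg_distrib, sum_unitAt]; ring
  have hadm : IsAdmissible k T none m c' g' τ' := by
    refine ⟨h.symm, h.nonneg, h.diag, fun w hw => ?_, fun w hw => ?_, fun w hw => ?_,
      ?_, fun j => ?_, fun A hA hAT hA0 _ => ?_, by simp⟩
    · have h1 := h.fixed_le w hw
      have h2 := h.fixed_even w hw
      simp only [hc', hg', unitAt]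
      rw [abs_le] at h1 ⊢
      split_ifs with h3
      · subst h3; omega
      · omega
    · have h2 := h.fixed_even w hw
      simp only [hc', hg']; omega
    · have := h.even w hw
      rw [hbd]
      simp only [hτ', unitAt, Finset.mem_singleton, eq_comm (a := w)]
      split_ifs <;> omega
    · rw [hsum, hsum]
      have := h.total
      rwa [sub_sub_sub_cancel_right]
    · have := h.root j
      rw [hsum, hsum, if_pos hv]
      generalize 2 * k * j = y at *
      grind
    · rw [hbd, hsum]
      by_cases hvA : v ∈ A
      · rw [if_pos hvA]
        by_cases h2 : 2 ≤ A.card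
        · obtain ⟨j, hj⟩ := H A hA hAT h2
          refine ⟨j, ?_⟩
          simp only [abs_eq_max_neg] at hj ⊢
          generalize 2 * k * j = y at *
          omega
        · have h1 : A.card = 1 := by have := Finset.card_pos.2 hA0; omega
          obtain ⟨w, rfl⟩ := Finset.card_eq_one.1 h1
          have : v = w := by simpa using hvA
          subst this
          obtain ⟨j, hj⟩ := exists_shift_sub_one hpos hk
          refine ⟨j, ?_⟩
          rw [(ht v hv).2.2, Finset.sum_singleton]
          omega
      · simpa [hvA] using h.cut A hA hAT hA0 (by simp)
  have hsm : Smaller T m c' T m c := by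
    refine Or.inr ⟨rfl, Or.inr ⟨rfl, ?_⟩⟩
    rw [hc', hsum, if_pos hv]
    omega
  obtain ⟨f, hf, hft⟩ := ih _ _ _ _ _ _ hadm hsm
  refine h.hasFlow_of_tight hk ht hf fun w hw => ?_
  have := (hft w hw).1
  have e : ∑ u ∈ T, f w u + g' w - τ' w = ∑ u ∈ T, f w u + g w - τ w := by
    simp only [hg', hτ']; ring
  rwa [e] at this

/-- When all demands are positive and all fixed edges are directed inwards, fictitious fixed
edges at the head of a free edge make it possible to delete that edge. -/
lemma hasFlow_of_pos (h : IsAdmissible k T none m c g τ) (ih : AllSmaller k T m c)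
    (hk : 1 ≤ k) (hT : 2 ≤ T.card) (H : ∀ A ⊆ T, A ≠ T → 2 ≤ A.card → IsSlack k T m c τ A)
    (ht : IsTight k T m c τ) (hpos : ∀ v ∈ T, 0 < τ v) (hlt : ∀ v ∈ T, τ v < k)
    (hg : ∀ v ∈ T, g v = -c v) : HasFlow k T m g τ := by
  have hgs : ∑ v ∈ T, g v = -∑ v ∈ T, c v := by
    rw [Finset.sum_congr rfl hg, Finset.sum_neg_distrib]
  have hC0 : 0 ≤ ∑ v ∈ T, c v := Finset.sum_nonneg fun v hv => h.fixed_nonneg hv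
  have hC : ∑ v ∈ T, c v ≤ 2 * k - 1 := by
    have := h.root (-1)
    rw [hgs] at this
    grind
  obtain ⟨u, hu, v, hv, hm⟩ : ∃ u ∈ T, ∃ v ∈ T, 0 < m u v := by
    by_contra hno
    push Not at hno
    obtain ⟨a, ha, b, hb, hab⟩ := Finset.one_lt_card.1 hT
    have h1 : ∀ w ∈ T, 2 * k - 1 ≤ c w := by
      intro w hw
      have h2 := (ht w hw).2.2
      have h3 := hpos w hw
      rw [boundary_singleton c h.diag hw, Finset.sum_eq_zero fun u hu =>
        le_antisymm (hno w hw u hu) (h.nonneg w u), abs_of_pos h3] at h2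
      omega
    have h4 : ∑ w ∈ ({a, b} : Finset V), c w ≤ ∑ w ∈ T, c w :=
      Finset.sum_le_sum_of_subset_of_nonneg (by simp [Finset.insert_subset_iff, ha, hb])
        fun w hw _ => h.fixed_nonneg hw
    rw [Finset.sum_pair hab] at h4
    have := h1 a ha
    have := h1 b hb
    omega
  have huv : u ≠ v := by rintro rfl; rw [h.diag] at hm; exact lt_irrefl _ hm
  obtain ⟨w, hw⟩ : ∃ w, w = k - τ v := ⟨_, rfl⟩
  have hw1 : 1 ≤ w := by have := hlt v hv; omega
  have hw2 : w ≤ k - 1 := by have := hpos v hv; omega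
  set m' : V → V → ℤ := fun a b => m a b - edgeAt u v a b with hm'
  set c' : V → ℤ := fun a => c a + w * unitAt v a with hc'
  set g' : V → ℤ := fun a => g a + w * unitAt v a with hg'
  set τ' : V → ℤ := fun a => τ a + ((w + 1) * unitAt v a - unitAt u a) with hτ'
  have hbd : ∀ A, boundary T m' c' A = boundary T m c A - (if (u ∈ A ↔ v ∈ A) then 0 else 1) +
      if v ∈ A then w else 0 := by
    intro A
    rw [hc', boundary_fixed, hm', boundary_sub_edgeAt m c hu hv, ← Finset.mul_sum, sum_unitAt]
    simp
  have hsum : ∀ (F : V → ℤ) (A : Finset V), ∑ a ∈ A, (F a + w * unitAt v a) =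
      ∑ a ∈ A, F a + if v ∈ A then w else 0 := by
    intro F A
    rw [Finset.sum_add_distrib, ← Finset.mul_sum, sum_unitAt]; simp
  have hsumτ : ∀ A : Finset V, ∑ a ∈ A, τ' a =
      ∑ a ∈ A, τ a + ((if v ∈ A then w + 1 else 0) - if u ∈ A then 1 else 0) := by
    intro A
    simp only [hτ', Finset.sum_add_distrib, Finset.sum_sub_distrib, sum_unitAt, ← Finset.mul_sum]
    simp
  have hadm : IsAdmissible k T none m' c' g' τ' := by
    refine ⟨fun a b => ?_, fun a b => ?_, fun a => ?_, fun a ha => ?_, fun a ha => ?_,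
      fun a ha => ?_, ?_, fun j => ?_, fun A hA hAT hA0 _ => ?_, by simp⟩
    · simp only [hm', h.symm a b, edgeAt_symm _ _ a b]
    · have h1 := h.nonneg a b
      have h3 := h.symm u v
      simp only [hm']
      rcases edgeAt_cases huv a b with ⟨rfl, rfl, e1, -⟩ | ⟨rfl, rfl, e1, -⟩ | ⟨e1, -⟩ <;> omega
    · simp only [hm', h.diag, edgeAt_self huv]; rfl
    · have h1 := h.fixed_le a ha
      simp only [hc', hg', unitAt]
      rw [abs_le] at h1 ⊢
      split_ifs <;> omega
    · have h2 := h.fixed_even a ha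
      simp only [hc', hg']
      omega
    · have := h.even a ha
      rw [hbd]
      simp only [hτ', unitAt, Finset.mem_singleton, eq_comm (a := a)]
      by_cases h1 : u = a <;> by_cases h2 : v = a <;> simp [h1, h2] <;> omega
    · rw [hsumτ, hsum, if_pos hv, if_pos hu, if_pos hv]
      have := h.total
      have e : ∑ a ∈ T, τ a + (w + 1 - 1) - (∑ a ∈ T, g a + w) = ∑ a ∈ T, τ a - ∑ a ∈ T, g a := by
        ring
      rwa [e]
    · rw [hsum, hsum, if_pos hv, hgs]
      rcases lt_trichotomy j 0 with hj | rfl | hj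
      · have : 2 * k * j ≤ -(2 * k) := by nlinarith
        simp only [abs_eq_max_neg]
        generalize 2 * k * j = y at *
        omega
      · simp only [abs_eq_max_neg]
        omega
      · have : 2 * k ≤ 2 * k * j := by nlinarith
        simp only [abs_eq_max_neg]
        generalize 2 * k * j = y at *
        omega
    · rw [hbd, hsumτ]
      by_cases h2 : 2 ≤ A.card
      · obtain ⟨j, hj⟩ := H A hA hAT h2
        refine ⟨j, ?_⟩
        simp only [abs_eq_max_neg] at hj ⊢
        generalize 2 * k * j = y at *
        split_ifs <;> omega
      · have h1 : A.card = 1 := by have := Finset.card_pos.2 hA0; omega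
        obtain ⟨a, rfl⟩ := Finset.card_eq_one.1 h1
        have haT : a ∈ T := by simpa using hA
        simp only [Finset.mem_singleton, Finset.sum_singleton]
        rw [(ht a haT).2.2]
        have h3 := hpos a haT
        have h4 := hlt a haT
        rw [abs_of_pos h3]
        by_cases hva : v = a
        · subst hva
          refine ⟨1, ?_⟩
          simp only [huv, iff_true, if_true, if_false]
          simp only [abs_eq_max_neg]
          omega
        · refine ⟨0, ?_⟩
          simp only [hva, if_false, iff_false]
          simp only [abs_eq_max_neg]
          split_ifs <;> omega
  have hsm : Smaller T m' c' T m c := by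
    refine Or.inr ⟨rfl, Or.inl ?_⟩
    simp only [hm', Finset.sum_sub_distrib, sum_edgeAt hu hv]
    omega
  obtain ⟨f, hf, hft⟩ := ih _ _ _ _ _ _ hadm hsm
  refine h.hasFlow_of_tight hk ht (hf.add_edge (Or.inl rfl) huv) fun a ha => ?_
  have e : ∑ b ∈ T, (f a b + 1 * arcAt u v a b) + g a - τ a = ∑ b ∈ T, f a b + g' a - τ' a := by
    simp only [Finset.sum_add_distrib, ← Finset.mul_sum, sum_arcAt hu hv, hτ', hg']
    ring
  rw [e]
  exact (hft a ha).1


lemma IsAdmissible.neg (h : IsAdmissible k T none m c g τ) :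
    IsAdmissible k T none m c (fun v => -g v) (fun v => -τ v) := by
  refine ⟨h.symm, h.nonneg, h.diag, fun v hv => by rw [abs_neg]; exact h.fixed_le v hv,
    fun v hv => by have := h.fixed_even v hv; omega, fun v hv => by have := h.even v hv; omega,
    ?_, fun j => ?_, fun A hA hAT hA0 hAx => ?_, by simp⟩
  · rw [Finset.sum_neg_distrib, Finset.sum_neg_distrib, ← dvd_neg]
    have := h.total
    rwa [show ∑ v ∈ T, τ v - ∑ v ∈ T, g v = -(-∑ v ∈ T, τ v - -∑ v ∈ T, g v) by ring] at this
  · have := h.root (-j)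
    rwa [← abs_neg, show -(∑ v ∈ T, g v - 2 * k * -j) = ∑ v ∈ T, -g v - 2 * k * j by
      rw [Finset.sum_neg_distrib]; ring] at this
  · obtain ⟨j, hj⟩ := h.cut A hA hAT hA0 hAx
    refine ⟨-j, ?_⟩
    rwa [← abs_neg, show -(∑ v ∈ A, τ v - 2 * k * j) = ∑ v ∈ A, -τ v - 2 * k * -j by
      rw [Finset.sum_neg_distrib]; ring] at hj

lemma IsSlack.neg {A : Finset V} (h : IsSlack k T m c τ A) :
    IsSlack k T m c (fun v => -τ v) A := by
  obtain ⟨j, hj⟩ := h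
  refine ⟨-j, ?_⟩
  rwa [← abs_neg, show -(∑ v ∈ A, τ v - 2 * k * j) = ∑ v ∈ A, -τ v - 2 * k * -j by
    rw [Finset.sum_neg_distrib]; ring] at hj

lemma IsTight.neg (h : IsTight k T m c τ) : IsTight k T m c (fun v => -τ v) := by
  intro v hv
  rw [abs_neg, neg_ne_zero]
  exact h v hv

omit [DecidableEq V] in
lemma HasFlow.of_neg (h : HasFlow k T m (fun v => -g v) (fun v => -τ v)) : HasFlow k T m g τ := by
  obtain ⟨f, hf, hft⟩ := h
  refine ⟨fun u v => -f u v, ⟨fun u v => by rw [hf.antisymm u v],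
    fun u hu v hv => by rw [abs_neg]; exact hf.le u hu v hv,
    fun u hu v hv => by have := hf.even u hu v hv; omega⟩, fun v hv => ?_⟩
  have h1 := hft v hv
  have e1 : ∑ u ∈ T, -f v u + g v - τ v = -(∑ u ∈ T, f v u + -g v - -τ v) := by
    rw [Finset.sum_neg_distrib]; ring
  have e2 : ∑ u ∈ T, -f v u + g v = -(∑ u ∈ T, f v u + -g v) := by
    rw [Finset.sum_neg_distrib]; ring
  rw [e1, dvd_neg, e2, abs_neg]
  exact h1

omit [DecidableEq V] in
lemma exists_sum_shift {τ' : V → ℤ} (hτ : ∀ v ∈ T, 2 * k ∣ τ v - τ' v) {A : Finset V}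
    (hA : A ⊆ T) : ∃ i, ∀ j, ∑ v ∈ A, τ' v - 2 * k * (j - i) = ∑ v ∈ A, τ v - 2 * k * j := by
  have : 2 * k ∣ ∑ v ∈ A, (τ v - τ' v) := Finset.dvd_sum fun v hv => hτ v (hA hv)
  rw [Finset.sum_sub_distrib] at this
  obtain ⟨i, hi⟩ := this
  exact ⟨i, fun j => by linear_combination -hi⟩

lemma IsSlack.congr {τ' : V → ℤ} (hτ : ∀ v ∈ T, 2 * k ∣ τ v - τ' v) {A : Finset V}
    (hA : A ⊆ T) (h : IsSlack k T m c τ A) : IsSlack k T m c τ' A := by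
  obtain ⟨i, hi⟩ := exists_sum_shift hτ hA
  obtain ⟨j, hj⟩ := h
  exact ⟨j - i, by rwa [hi]⟩

lemma IsAdmissible.congr (h : IsAdmissible k T none m c g τ) {τ' : V → ℤ}
    (hτ : ∀ v ∈ T, 2 * k ∣ τ v - τ' v) : IsAdmissible k T none m c g τ' := by
  refine ⟨h.symm, h.nonneg, h.diag, h.fixed_le, h.fixed_even, fun v hv => ?_, ?_, h.root,
    fun A hA hAT hA0 hAx => ?_, by simp⟩
  · have h1 := h.even v hv
    have h2 : 2 ∣ τ v - τ' v := (dvd_mul_right 2 k).trans (hτ v hv)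
    omega
  · have h1 : 2 * k ∣ ∑ v ∈ T, (τ v - τ' v) := Finset.dvd_sum hτ
    rw [Finset.sum_sub_distrib] at h1
    have h2 := dvd_sub h.total h1
    rwa [show ∑ v ∈ T, τ v - ∑ v ∈ T, g v - (∑ v ∈ T, τ v - ∑ v ∈ T, τ' v) =
      ∑ v ∈ T, τ' v - ∑ v ∈ T, g v by ring] at h2
  · obtain ⟨i, hi⟩ := exists_sum_shift hτ hA
    obtain ⟨j, hj⟩ := h.cut A hA hAT hA0 hAx
    exact ⟨j - i, by rwa [hi]⟩

omit [DecidableEq V] in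
lemma HasFlow.congr {τ' : V → ℤ} (hτ : ∀ v ∈ T, 2 * k ∣ τ v - τ' v) (h : HasFlow k T m g τ') :
    HasFlow k T m g τ := by
  obtain ⟨f, hf, hft⟩ := h
  refine ⟨f, hf, fun v hv => ⟨?_, (hft v hv).2⟩⟩
  have := dvd_sub (hft v hv).1 (hτ v hv)
  rwa [show ∑ u ∈ T, f v u + g v - τ' v - (τ v - τ' v) = ∑ u ∈ T, f v u + g v - τ v by ring]
    at this

lemma IsAdmissible.hasFlow_of_isTight (h : IsAdmissible k T none m c g τ)
    (ih : AllSmaller k T m c) (hk : 1 ≤ k) (hT : 2 ≤ T.card)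
    (H : ∀ A ⊆ T, A ≠ T → 2 ≤ A.card → IsSlack k T m c τ A)
    (ht : IsTight k T m c τ) : HasFlow k T m g τ := by
  by_contra hno
  have hneg : ¬ HasFlow k T m (fun v => -g v) (fun v => -τ v) := fun h' => hno h'.of_neg
  have H' : ∀ A ⊆ T, A ≠ T → 2 ≤ A.card → IsSlack k T m c (fun v => -τ v) A :=
    fun A hA hAT h2 => (H A hA hAT h2).neg
  have e1 : ∀ u ∈ T, ∀ v ∈ T, 0 < m u v → (0 < τ u ∨ |τ u| = k) → ¬ (τ v < 0 ∨ |τ v| = k) :=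
    fun u hu v hv hm h1 h2 => hno (hasFlow_of_delete h ih hk hu hv hm H ht h1 h2)
  have e2 : ∀ v ∈ T, (0 < τ v ∨ |τ v| = k) → g v = -c v := by
    intro v hv h1
    have h2 := h.fixed_le v hv
    by_contra h3
    rw [abs_le] at h2
    exact hno (hasFlow_of_delete_fixed h ih hk hv (lt_of_le_of_ne h2.1 (Ne.symm h3)) H ht h1)
  have e3 : ∀ v ∈ T, (τ v < 0 ∨ |τ v| = k) → g v = c v := by
    intro v hv h1
    have h2 := h.fixed_le v hv
    by_contra h3
    rw [abs_le] at h2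
    refine hneg (hasFlow_of_delete_fixed h.neg ih hk hv ?_ H' ht.neg ?_)
    · show -c v < -g v
      exact neg_lt_neg (lt_of_le_of_ne h2.2 h3)
    · rwa [abs_neg, neg_pos]
  have hlt : ∀ v ∈ T, |τ v| < k := by
    intro v hv
    refine lt_of_le_of_ne (ht v hv).1 fun hvk => ?_
    have hc : c v = 0 := by
      have := e2 v hv (Or.inr hvk)
      have := e3 v hv (Or.inr hvk)
      omega
    have hm : ∀ u ∈ T, m v u = 0 := by
      intro u hu
      by_contra hmu
      have hmu' : 0 < m v u := lt_of_le_of_ne (h.nonneg v u) (Ne.symm hmu)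
      rcases lt_or_gt_of_ne (ht u hu).2.1 with h1 | h1
      · exact e1 v hv u hu hmu' (Or.inr hvk) (Or.inl h1)
      · exact e1 u hu v hv (by rwa [h.symm]) (Or.inl h1) (Or.inr hvk)
    have hb := (ht v hv).2.2
    rw [boundary_singleton c h.diag hv, Finset.sum_eq_zero hm, hc] at hb
    omega
  by_cases hpos : ∀ v ∈ T, 0 < τ v
  · exact hno (hasFlow_of_pos h ih hk hT H ht hpos
      (fun v hv => (le_abs_self _).trans_lt (hlt v hv)) fun v hv => e2 v hv (Or.inl (hpos v hv)))
  by_cases hneg' : ∀ v ∈ T, τ v < 0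
  · refine hneg (hasFlow_of_pos h.neg ih hk hT H' ht.neg (fun v hv => neg_pos.2 (hneg' v hv))
      (fun v hv => (neg_le_abs _).trans_lt (hlt v hv)) fun v hv => ?_)
    rw [e3 v hv (Or.inl (hneg' v hv))]
  push Not at hpos hneg'
  obtain ⟨a, ha, hat⟩ := hpos
  obtain ⟨b, hb, hbt⟩ := hneg'
  set P := T.filter (0 < τ ·) with hP
  have hPT : P ⊆ T := Finset.filter_subset _ _
  have hbP : b ∈ P := Finset.mem_filter.2 ⟨hb, lt_of_le_of_ne hbt (Ne.symm (ht b hb).2.1)⟩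
  have haP : a ∈ T \ P := Finset.mem_sdiff.2 ⟨ha, fun h' => not_lt.2 hat (Finset.mem_filter.1 h').2⟩
  have hPs : ∀ v ∈ P, 0 < τ v := fun v hv => (Finset.mem_filter.1 hv).2
  have hNs : ∀ v ∈ T \ P, τ v < 0 := by
    intro v hv
    rw [Finset.mem_sdiff, hP, Finset.mem_filter] at hv
    exact lt_of_le_of_ne (not_lt.1 fun h' => hv.2 ⟨hv.1, h'⟩) (ht v hv.1).2.1
  have hcross : ∀ u ∈ P, ∀ v ∈ T \ P, m u v = 0 := by
    intro u hu v hv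
    by_contra hmu
    exact e1 u (hPT hu) v (Finset.mem_sdiff.1 hv).1 (lt_of_le_of_ne (h.nonneg u v) (Ne.symm hmu))
      (Or.inl (hPs u hu)) (Or.inl (hNs v hv))
  have hbP1 : boundary T m c P = ∑ v ∈ P, c v := by
    rw [boundary, Finset.sum_eq_zero fun u hu => Finset.sum_eq_zero (hcross u hu), zero_add]
  have hbN1 : boundary T m c (T \ P) = ∑ v ∈ T \ P, c v := by
    rw [boundary, Finset.sdiff_sdiff_eq_self hPT, Finset.sum_eq_zero fun u hu =>
      Finset.sum_eq_zero fun v hv => by rw [h.symm]; exact hcross v hv u hu, zero_add]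
  have hPne : P ≠ T := by
    intro h'; rw [h', Finset.sdiff_self] at haP; simp at haP
  have hNne : T \ P ≠ T := by
    intro h'; have := hPT hbP; rw [← h'] at this; exact (Finset.mem_sdiff.1 this).2 hbP
  obtain ⟨i, hi⟩ := h.cut P hPT hPne ⟨b, hbP⟩ (by simp)
  obtain ⟨j, hj⟩ := h.cut (T \ P) Finset.sdiff_subset hNne ⟨a, haP⟩ (by simp)
  have hr := h.root 0
  have g1 : ∑ v ∈ P, g v = -∑ v ∈ P, c v := by
    rw [← Finset.sum_neg_distrib]
    exact Finset.sum_congr rfl fun v hv => e2 v (hPT hv) (Or.inl (hPs v hv))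
  have g2 : ∑ v ∈ T \ P, g v = ∑ v ∈ T \ P, c v :=
    Finset.sum_congr rfl fun v hv => e3 v (Finset.mem_sdiff.1 hv).1 (Or.inl (hNs v hv))
  rw [← Finset.sum_sdiff hPT, ← Finset.sum_sdiff hPT (f := g), g1, g2] at hr
  rw [hbP1] at hi
  rw [hbN1] at hj
  have h1 := abs_nonneg (∑ v ∈ P, τ v - 2 * k * i)
  have h2 := abs_nonneg (∑ v ∈ T \ P, τ v - 2 * k * j)
  have h3 := hlt b hb
  have h4 := abs_pos.2 (ht b hb).2.1
  simp only [abs_eq_max_neg] at hr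
  omega

lemma IsAdmissible.hasFlow_of_card_le_one (h : IsAdmissible k T x m c g τ) (hk : 1 ≤ k)
    (hT : T.card ≤ 1) : HasFlow k T m g τ := by
  have hT' : ∀ u ∈ T, ∀ v ∈ T, u = v := Finset.card_le_one.1 hT
  refine ⟨fun _ _ => 0, ⟨by simp, fun u _ v _ => by simpa using h.nonneg u v, fun u hu v hv => ?_⟩,
    fun v hv => ?_⟩
  · rw [hT' u hu v hv, h.diag]; simp
  · have hTv : T = {v} := by
      ext u; simp only [Finset.mem_singleton]
      exact ⟨fun hu => hT' u hu v hv, by rintro rfl; exact hv⟩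
    have h1 := h.total
    have h2 := h.root 1
    have h3 := h.root (-1)
    have h4 := h.fixed_le v hv
    simp only [hTv, Finset.sum_singleton] at h1 h2 h3
    rw [Finset.sum_const_zero, zero_add]
    refine ⟨by rwa [← dvd_neg, neg_sub], ?_⟩
    simp only [abs_eq_max_neg] at *
    omega

lemma exists_close (k : ℤ) (hk : 1 ≤ k) (τ D : ℤ) (h1 : ∃ j, |τ - 2 * k * j| + 2 * k - 2 ≤ D)
    (h2 : ∀ j, D ≤ 2 * k - 2 + |τ - 2 * k * j|) :
    ∃ t, 2 * k ∣ τ - t ∧ |t| ≤ k ∧ D = 2 * k - 2 + |t| := by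
  obtain ⟨j, hj⟩ := h1
  refine ⟨τ - 2 * k * j, ⟨j, by ring⟩, ?_, ?_⟩
  · have h3 := h2 (j + 1)
    have h4 := h2 (j - 1)
    rw [show τ - 2 * k * (j + 1) = τ - 2 * k * j - 2 * k by ring] at h3
    rw [show τ - 2 * k * (j - 1) = τ - 2 * k * j + 2 * k by ring] at h4
    simp only [abs_eq_max_neg] at *
    omega
  · have := h2 j; omega

lemma IsAdmissible.hasFlow_of_allSmaller (h : IsAdmissible k T x m c g τ)
    (ih : AllSmaller k T m c) (hk : 1 ≤ k) : HasFlow k T m g τ := by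
  by_cases hT : T.card ≤ 1
  · exact h.hasFlow_of_card_le_one hk hT
  push Not at hT
  by_cases H : ∀ A ⊆ T, A ≠ T → 2 ≤ A.card → IsSlack k T m c τ A
  swap
  · push Not at H
    obtain ⟨A, hA, hAT, hA2, hns⟩ := H
    exact hasFlow_of_contract h ih hA hAT hA2 hns
  by_cases hx : ∃ v ∈ T, x = some v
  · obtain ⟨v, hv, hxv⟩ := hx
    exact hasFlow_of_split h ih hk hT hv (Or.inl hxv) H
  have h0 : IsAdmissible k T none m c g τ := by
    refine ⟨h.symm, h.nonneg, h.diag, h.fixed_le, h.fixed_even, h.even, h.total, h.root,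
      fun A hA hAT hA0 _ => h.cut A hA hAT hA0 ?_, by simp⟩
    rintro v hv rfl
    exact hx ⟨v, by simpa using hA, hv⟩
  by_cases hs : ∃ v ∈ T, IsSlack k T m c τ {v}
  · obtain ⟨v, hv, hsv⟩ := hs
    exact hasFlow_of_split h0 ih hk hT hv (Or.inr ⟨rfl, hsv⟩) H
  push Not at hs
  have hclose : ∀ v, ∃ t, v ∈ T → 2 * k ∣ τ v - t ∧ |t| ≤ k ∧
      boundary T m c {v} = 2 * k - 2 + |t| := by
    intro v
    by_cases hv : v ∈ T
    · obtain ⟨t, ht⟩ := exists_close k hk (τ v) (boundary T m c {v}) (by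
        have := h0.cut {v} (by simpa) (by rintro rfl; simp at hT) (by simp) (by simp)
        simpa using this) (fun j => by
        simpa using h0.le_of_not_isSlack (by simpa) (hs v hv) j)
      exact ⟨t, fun _ => ht⟩
    · exact ⟨0, fun h' => absurd h' hv⟩
  choose t ht using hclose
  have hcong : ∀ v ∈ T, 2 * k ∣ τ v - t v := fun v hv => (ht v hv).1
  refine HasFlow.congr hcong ?_
  have h1 := h0.congr hcong
  have H1 : ∀ A ⊆ T, A ≠ T → 2 ≤ A.card → IsSlack k T m c t A :=
    fun A hA hAT hA2 => (H A hA hAT hA2).congr hcong hA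
  by_cases h0t : ∃ v ∈ T, t v = 0
  · obtain ⟨v, hv, hv0⟩ := h0t
    refine hasFlow_of_split (x := some v) ⟨h1.symm, h1.nonneg, h1.diag, h1.fixed_le, h1.fixed_even,
      h1.even, h1.total, h1.root, fun A hA hAT hA0 _ => h1.cut A hA hAT hA0 (by simp), ?_⟩ ih hk hT
      hv (Or.inl rfl) H1
    intro w _ hw
    cases hw
    simp [hv0]
  · push Not at h0t
    exact h1.hasFlow_of_isTight ih hk hT H1 fun v hv => ⟨(ht v hv).2.1, h0t v hv, (ht v hv).2.2⟩

/-- The bounded modular orientation theorem (Lovász, Thomassen, Wu and Zhang). -/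
theorem IsAdmissible.hasFlow (h : IsAdmissible k T x m c g τ) (hk : 1 ≤ k) :
    HasFlow k T m g τ := by
  have key : ∀ n E C : ℕ, ∀ T x m c g τ, IsAdmissible (V := V) k T x m c g τ → T.card = n →
      (∑ u ∈ T, ∑ v ∈ T, m u v).toNat = E → (∑ v ∈ T, c v).toNat = C → HasFlow k T m g τ := by
    intro n
    induction n using Nat.strong_induction_on with
    | _ n ihn =>
      intro E
      induction E using Nat.strong_induction_on with
      | _ E ihE =>
        intro C
        induction C using Nat.strong_induction_on with
        | _ C ihC =>
          intro T x m c g τ h hn hE hC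
          refine h.hasFlow_of_allSmaller (fun T' x' m' c' g' τ' h' hs => ?_) hk
          have hE0 : 0 ≤ ∑ u ∈ T', ∑ v ∈ T', m' u v :=
            Finset.sum_nonneg fun u _ => Finset.sum_nonneg fun v _ => h'.nonneg u v
          have hC0 : 0 ≤ ∑ v ∈ T', c' v := Finset.sum_nonneg fun v hv => h'.fixed_nonneg hv
          rcases hs with hs | ⟨rfl, hs | ⟨hs1, hs2⟩⟩
          · exact ihn _ (by omega) _ _ _ _ _ _ _ _ h' rfl rfl rfl
          · exact ihE _ (by omega) _ _ _ _ _ _ _ h' hn rfl rfl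
          · exact ihC _ (by omega) _ _ _ _ _ _ h' hn (by rw [hs1]; exact hE) rfl
  exact key _ _ _ T x m c g τ h rfl rfl rfl

end Core

section Signs

variable {V ι : Type*} [DecidableEq V]

/-- The number of ends of the edge `e` at `v`. -/
def endsAt (a b : ι → V) (e : ι) (v : V) : ℤ := unitAt (a e) v + unitAt (b e) v

def IsSign (s : ℤ) : Prop := s = 1 ∨ s = -1

lemma IsFlow.exists_signs [DecidableEq ι] {T : Finset V} (B : Finset ι) {a b : ι → V}
    (hB : ∀ e ∈ B, a e ∈ T ∧ b e ∈ T ∧ a e ≠ b e) {f : V → V → ℤ}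
    (hf : IsFlow T (fun u v => ∑ e ∈ B, edgeAt (a e) (b e) u v) f) :
    ∃ r : ι → ℤ, (∀ e, IsSign (r e)) ∧
      ∀ v ∈ T, ∑ u ∈ T, f v u = ∑ e ∈ B, r e * (unitAt (a e) v - unitAt (b e) v) := by
  induction B using Finset.induction_on generalizing f with
  | empty =>
    refine ⟨fun _ => 1, fun _ => Or.inl rfl, fun v hv => ?_⟩
    rw [Finset.sum_empty]
    refine Finset.sum_eq_zero fun u hu => ?_
    simpa using hf.le v hv u hu
  | insert e B he ih =>
    obtain ⟨ha, hb, hab⟩ := hB e (Finset.mem_insert_self _ _)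
    have hf' : IsFlow T (fun u v => ∑ e ∈ B, edgeAt (a e) (b e) u v + edgeAt (a e) (b e) u v) f := by
      simpa only [Finset.sum_insert he, add_comm] using hf
    obtain ⟨s, hs, hf1⟩ := IsFlow.remove_edge (m := fun u v => ∑ e ∈ B, edgeAt (a e) (b e) u v)
      hab ha hb (Finset.sum_congr rfl fun _ _ => edgeAt_symm _ _ _ _)
      (Finset.sum_nonneg fun _ _ => edgeAt_nonneg _ _ _ _) hf'
    obtain ⟨r, hr, hrs⟩ := ih (fun e he => hB e (Finset.mem_insert_of_mem he)) hf1
    refine ⟨Function.update r e s, fun e' => ?_, fun v hv => ?_⟩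
    · by_cases h : e' = e
      · subst h; rw [Function.update_self]; exact hs
      · rw [Function.update_of_ne h]; exact hr e'
    · have h1 := hrs v hv
      rw [Finset.sum_sub_distrib, ← Finset.mul_sum, sum_arcAt ha hb] at h1
      rw [Finset.sum_insert he, Function.update_self]
      have h2 : ∑ e' ∈ B, Function.update r e s e' * (unitAt (a e') v - unitAt (b e') v) =
          ∑ e' ∈ B, r e' * (unitAt (a e') v - unitAt (b e') v) :=
        Finset.sum_congr rfl fun e' he' => by
          rw [Function.update_of_ne (by rintro rfl; exact he he')]
      rw [h2, ← h1]; ring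

lemma sum_endsAt {T : Finset V} {a b : ι → V} {e : ι} (ha : a e ∈ T) (hb : b e ∈ T) :
    ∑ v ∈ T, endsAt a b e v = 2 := by
  simp only [endsAt, Finset.sum_add_distrib, sum_unitAt, ha, hb, if_true]; rfl

lemma endsAt_nonneg (a b : ι → V) (e : ι) (v : V) : 0 ≤ endsAt a b e v := by
  simp only [endsAt, unitAt]; split_ifs <;> simp

lemma sum_sum_mul_endsAt {T : Finset V} {a b : ι → V} {R : Finset ι}
    (hR : ∀ e ∈ R, a e ∈ T ∧ b e ∈ T) (r : ι → ℤ) :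
    ∑ v ∈ T, ∑ e ∈ R, r e * endsAt a b e v = 2 * ∑ e ∈ R, r e := by
  rw [Finset.sum_comm, Finset.mul_sum]
  refine Finset.sum_congr rfl fun e he => ?_
  rw [← Finset.mul_sum, sum_endsAt (hR e he).1 (hR e he).2, mul_comm]

lemma IsSign.two_dvd_sub {r s : ℤ} (hr : IsSign r) (hs : IsSign s) : 2 ∣ r - s := by
  rcases hr with rfl | rfl <;> rcases hs with rfl | rfl <;> norm_num

lemma two_dvd_sum_mul_endsAt_sub (a b : ι → V) (R : Finset ι) {r s : ι → ℤ} (hr : ∀ e, IsSign (r e))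
    (hs : ∀ e, IsSign (s e)) (v : V) :
    2 ∣ ∑ e ∈ R, r e * endsAt a b e v - ∑ e ∈ R, s e * endsAt a b e v := by
  rw [← Finset.sum_sub_distrib]
  refine Finset.dvd_sum fun e _ => ?_
  rw [← sub_mul]
  exact ((hr e).two_dvd_sub (hs e)).mul_right _

lemma two_dvd_sum_mul_endsAt (a b : ι → V) (R : Finset ι) {r : ι → ℤ} (hr : ∀ e, IsSign (r e))
    (v : V) : 2 ∣ ∑ e ∈ R, r e * endsAt a b e v + ∑ e ∈ R, endsAt a b e v := by
  simpa using two_dvd_sum_mul_endsAt_sub a b R hr (s := fun _ => -1) (fun _ => Or.inr rfl) v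

lemma exists_signs_sum_eq [DecidableEq ι] (R : Finset ι) {P : ℕ} (hP : P ≤ R.card) :
    ∃ r : ι → ℤ, (∀ e, IsSign (r e)) ∧ ∑ e ∈ R, r e = 2 * P - R.card := by
  obtain ⟨S, hS, hSc⟩ := Finset.exists_subset_card_eq hP
  refine ⟨fun e => if e ∈ S then 1 else -1, fun e => by simp only [IsSign]; split_ifs <;> simp, ?_⟩
  rw [← Finset.sum_sdiff hS, Finset.sum_congr rfl fun e he => if_neg (Finset.mem_sdiff.1 he).2,
    Finset.sum_congr rfl fun e he => if_pos he]
  simp only [Finset.sum_const, Finset.card_sdiff_of_subset hS, hSc, nsmul_eq_mul]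
  push_cast [hP]; ring

/-- Solving the orientation problem when the signs of at most `k - 1` edges of `R` may be chosen
freely subject to a global congruence. -/
lemma exists_flow_of_fixed_edges [DecidableEq ι] {k : ℤ} (hk : 1 ≤ k) {T : Finset V} {m : V → V → ℤ}
    (hs : ∀ u v, m u v = m v u) (h0 : ∀ u v, 0 ≤ m u v) (hd : ∀ u, m u u = 0)
    (hcut : ∀ A ⊆ T, A ≠ T → A.Nonempty → 3 * k - 3 ≤ ∑ u ∈ A, ∑ v ∈ T \ A, m u v)
    {R : Finset ι} {a b : ι → V} (hR : ∀ e ∈ R, a e ∈ T ∧ b e ∈ T) (hRk : (R.card : ℤ) ≤ k - 1)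
    {P : ℕ} (hP : P ≤ R.card) {τ : V → ℤ}
    (hpar : ∀ v ∈ T, 2 ∣ τ v + ∑ u ∈ T, m v u + ∑ e ∈ R, endsAt a b e v)
    (htot : 2 * k ∣ ∑ v ∈ T, τ v - 2 * (2 * P - R.card)) :
    ∃ (f : V → V → ℤ) (r : ι → ℤ), IsFlow T m f ∧ (∀ e, IsSign (r e)) ∧ ∀ v ∈ T,
      2 * k ∣ ∑ u ∈ T, f v u + ∑ e ∈ R, r e * endsAt a b e v - τ v ∧
      |∑ u ∈ T, f v u + ∑ e ∈ R, r e * endsAt a b e v| < 2 * k := by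
  obtain ⟨r, hr, hrP⟩ := exists_signs_sum_eq R hP
  set c : V → ℤ := fun v => ∑ e ∈ R, endsAt a b e v with hc
  have hc0 : ∀ v, 0 ≤ c v := fun v => Finset.sum_nonneg fun e _ => endsAt_nonneg a b e v
  have hcs : ∑ v ∈ T, c v = 2 * R.card := by
    have := sum_sum_mul_endsAt hR (fun _ => 1)
    simpa using this
  have heven : ∀ v ∈ T, 2 ∣ τ v + boundary T m c {v} := by
    intro v hv
    rw [boundary_singleton c hd hv, ← add_assoc]
    exact hpar v hv
  have hadm : IsAdmissible k T none m c (fun v => ∑ e ∈ R, r e * endsAt a b e v) τ := by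
    refine ⟨hs, h0, hd, fun v _ => ?_, fun v _ => ?_, heven, ?_, fun j => ?_,
      fun A hA hAT hA0 _ => ?_, by simp⟩
    · refine (Finset.abs_sum_le_sum_abs _ _).trans (Finset.sum_le_sum fun e _ => ?_)
      rw [abs_mul, abs_of_nonneg (endsAt_nonneg a b e v)]
      rcases hr e with h | h <;> rw [h] <;> simp
    · rw [add_comm]; exact two_dvd_sum_mul_endsAt a b R hr v
    · rw [sum_sum_mul_endsAt hR, hrP]; exact htot
    · rw [hcs]
      have := abs_nonneg (∑ v ∈ T, ∑ e ∈ R, r e * endsAt a b e v - 2 * k * j)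
      omega
    · have h1 := two_dvd_sum_add_boundary hs hd heven hA
      have h2 := hcut A hA hAT hA0
      have h3 : 0 ≤ ∑ v ∈ A, c v := Finset.sum_nonneg fun v _ => hc0 v
      have h4 : 3 * k - 3 ≤ boundary T m c A := by rw [boundary]; omega
      generalize ∑ v ∈ A, τ v = t at *
      obtain ⟨j, hj⟩ : ∃ j : ℤ, |t - 2 * k * j| ≤ k := by
        refine ⟨(t + k) / (2 * k), ?_⟩
        have h5 := Int.emod_add_mul_ediv (t + k) (2 * k)
        have h6 := Int.emod_nonneg (t + k) (show 2 * k ≠ 0 by omega)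
        have h7 := Int.emod_lt_of_pos (t + k) (show 0 < 2 * k by omega)
        rw [abs_le]
        constructor <;> linarith
      refine ⟨j, ?_⟩
      have e : 2 * k * j = 2 * (k * j) := by ring
      rw [e] at hj ⊢
      simp only [abs_eq_max_neg] at *
      omega
  obtain ⟨f, hf, hft⟩ := hadm.hasFlow hk
  exact ⟨f, r, hf, hr, hft⟩

/-- The edges of `M` are pairwise disjoint. -/
def IsMatching (a b : ι → V) (M : Finset ι) : Prop :=
  ∀ e ∈ M, ∀ e' ∈ M, e ≠ e' → a e ≠ a e' ∧ a e ≠ b e' ∧ b e ≠ a e' ∧ b e ≠ b e'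

lemma IsMatching.sum_endsAt {a b : ι → V} {M : Finset ι} (hM : IsMatching a b M) (v : V) :
    (∀ r : ι → ℤ, ∑ e ∈ M, r e * endsAt a b e v = 0) ∨
    ∃ e ∈ M, (a e = v ∨ b e = v) ∧
      ∀ r : ι → ℤ, ∑ e ∈ M, r e * endsAt a b e v = r e * endsAt a b e v := by
  have h0 : ∀ e, ¬ (a e = v ∨ b e = v) → endsAt a b e v = 0 := by
    intro e h
    simp only [endsAt, unitAt]
    rw [if_neg (by tauto), if_neg (by tauto)]; rfl
  by_cases h : ∃ e ∈ M, a e = v ∨ b e = v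
  · obtain ⟨e, he, hev⟩ := h
    refine Or.inr ⟨e, he, hev, fun r => Finset.sum_eq_single_of_mem e he fun e' he' hne => ?_⟩
    rw [h0, mul_zero]
    have := hM e' he' e he hne
    rintro (h | h) <;> rcases hev with h' | h' <;> simp_all
  · push Not at h
    refine Or.inl fun r => Finset.sum_eq_zero fun e he => ?_
    rw [h0 e (by have := h e he; tauto), mul_zero]

lemma exists_signs_of_isMatching [DecidableEq ι] {k : ℤ} (hk : 1 ≤ k) {T : Finset V} {m : V → V → ℤ}
    (hs : ∀ u v, m u v = m v u) (h0 : ∀ u v, 0 ≤ m u v) (hd : ∀ u, m u u = 0)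
    (hcut : ∀ A ⊆ T, A ≠ T → A.Nonempty → 3 * k - 3 ≤ ∑ u ∈ A, ∑ v ∈ T \ A, m u v)
    {M R : Finset ι} {a b : ι → V} (hMR : Disjoint M R)
    (hM : ∀ e ∈ M, a e ∈ T ∧ b e ∈ T) (hR : ∀ e ∈ R, a e ∈ T ∧ b e ∈ T)
    (hRk : (R.card : ℤ) ≤ k - 1) {ε τ : V → ℤ} (hε : ∀ v, IsSign (ε v))
    (hεM : ∀ e ∈ M, ε (a e) = ε (b e))
    (hpar : ∀ v ∈ T, 2 ∣ τ v + ∑ u ∈ T, m v u + ∑ e ∈ M, endsAt a b e v +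
      ∑ e ∈ R, endsAt a b e v)
    (hreal : ∀ D : ℤ, |D| ≤ M.card → 2 ∣ D + M.card → ∃ P : ℕ, P ≤ R.card ∧
      2 * k ∣ ∑ v ∈ T, τ v - 2 * D - 2 * (2 * P - R.card))
    (hmat : IsMatching a b M) :
    ∃ (f : V → V → ℤ) (r : ι → ℤ), IsFlow T m f ∧ (∀ e, IsSign (r e)) ∧ ∀ v ∈ T,
      2 * k ∣ ∑ u ∈ T, f v u + ∑ e ∈ M, r e * endsAt a b e v +
        ∑ e ∈ R, r e * endsAt a b e v - τ v ∧
      -(2 * k) + 1 ≤ ε v * (∑ u ∈ T, f v u + ∑ e ∈ M, r e * endsAt a b e v +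
        ∑ e ∈ R, r e * endsAt a b e v) ∧
      ε v * (∑ u ∈ T, f v u + ∑ e ∈ M, r e * endsAt a b e v +
        ∑ e ∈ R, r e * endsAt a b e v) ≤ 2 * k := by
  have key : ∀ r₀ : ι → ℤ, (∀ e, IsSign (r₀ e)) → ∃ (f : V → V → ℤ) (r : ι → ℤ), IsFlow T m f ∧
      (∀ e, IsSign (r e)) ∧ ∀ v ∈ T,
      2 * k ∣ ∑ u ∈ T, f v u + ∑ e ∈ R, r e * endsAt a b e v -
        (τ v - ∑ e ∈ M, r₀ e * endsAt a b e v) ∧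
      |∑ u ∈ T, f v u + ∑ e ∈ R, r e * endsAt a b e v| < 2 * k := by
    intro r₀ hr₀
    obtain ⟨P, hP, hPk⟩ := hreal (∑ e ∈ M, r₀ e)
      ((Finset.abs_sum_le_sum_abs _ _).trans (by
        rw [Finset.sum_congr rfl fun e _ => show |r₀ e| = 1 by
          rcases hr₀ e with h | h <;> simp [h]]
        simp))
      (by
        have : 2 ∣ ∑ e ∈ M, (r₀ e + 1) := Finset.dvd_sum fun e _ => by
          rcases hr₀ e with h | h <;> simp [h]
        simpa [Finset.sum_add_distrib] using this)
    refine exists_flow_of_fixed_edges hk hs h0 hd hcut hR hRk hP (fun v hv => ?_) ?_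
    · have h1 := hpar v hv
      have h2 := two_dvd_sum_mul_endsAt a b M hr₀ v
      omega
    · rw [Finset.sum_sub_distrib, sum_sum_mul_endsAt hM]
      exact hPk
  have combine : ∀ (r₁ r : ι → ℤ) (v : V),
      ∑ e ∈ M, (if e ∈ M then r₁ e else r e) * endsAt a b e v =
        ∑ e ∈ M, r₁ e * endsAt a b e v ∧
      ∑ e ∈ R, (if e ∈ M then r₁ e else r e) * endsAt a b e v =
        ∑ e ∈ R, r e * endsAt a b e v := by
    intro r₁ r v
    exact ⟨Finset.sum_congr rfl fun e he => by rw [if_pos he],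
      Finset.sum_congr rfl fun e he => by rw [if_neg (Finset.disjoint_right.1 hMR he)]⟩
  have hnegs : ∀ v, IsSign (-ε v) := fun v => by rcases hε v with h | h <;> simp [h, IsSign]
  rcases hk.eq_or_lt with rfl | hk2
  · obtain ⟨f, r, hf, hr, hft⟩ := key (fun _ => 1) (fun _ => Or.inl rfl)
    set N : V → ℤ := fun v => ∑ u ∈ T, f v u + ∑ e ∈ R, r e * endsAt a b e v with hN
    set r₁ : ι → ℤ := fun e => if a e = b e ∧ 0 < ε (a e) * N (a e) then -ε (a e) else ε (a e)
      with hr₁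
    have hr₁s : ∀ e, IsSign (r₁ e) := by
      intro e; simp only [hr₁]; split_ifs
      · exact hnegs _
      · exact hε _
    refine ⟨f, fun e => if e ∈ M then r₁ e else r e, hf, fun e => ?_, fun v hv => ?_⟩
    · dsimp only; split_ifs
      · exact hr₁s e
      · exact hr e
    obtain ⟨h1, h2⟩ := hft v hv
    rw [(combine r₁ r v).1, (combine r₁ r v).2, add_right_comm]
    change 2 * 1 ∣ N v + _ - τ v ∧ _ ≤ ε v * (N v + _) ∧ ε v * (N v + _) ≤ _
    change 2 * 1 ∣ N v - _ at h1
    change |N v| < _ at h2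
    rw [abs_lt] at h2
    have h3 := two_dvd_sum_mul_endsAt_sub a b M hr₁s (s := fun _ => 1) (fun _ => Or.inl rfl) v
    refine ⟨by omega, ?_⟩
    rcases hmat.sum_endsAt v with h4 | ⟨e, he, hev, h4⟩
    · rw [h4]
      rcases hε v with h5 | h5 <;> rw [h5] <;> omega
    · rw [h4]
      have hea : ε (a e) = ε v := by
        rcases hev with rfl | rfl
        · rfl
        · exact hεM e he
      by_cases hab : a e = b e
      · have hae : a e = v := by rcases hev with h | h <;> simp [h, hab]
        have hbe : b e = v := hab ▸ hae
        simp only [hr₁, endsAt, unitAt, hae, hbe, if_true, true_and]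
        rcases hε v with h5 | h5 <;> rw [h5] <;> split_ifs <;> omega
      · have h6 : endsAt a b e v = 1 := by
          simp only [endsAt, unitAt]
          rcases hev with rfl | rfl
          · simp [hab]
          · simp [Ne.symm hab]
        rw [h6]
        simp only [hr₁, hab, false_and, if_false, hea]
        rcases hε v with h5 | h5 <;> rw [h5] <;> omega
  · set r₁ : ι → ℤ := fun e => if a e = b e ∧ 2 * k ∣ ε (a e) * τ (a e) - 1 then -ε (a e)
      else ε (a e) with hr₁
    have hr₁s : ∀ e, IsSign (r₁ e) := by
      intro e; simp only [hr₁]; split_ifs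
      · exact hnegs _
      · exact hε _
    obtain ⟨f, r, hf, hr, hft⟩ := key r₁ hr₁s
    refine ⟨f, fun e => if e ∈ M then r₁ e else r e, hf, fun e => ?_, fun v hv => ?_⟩
    · dsimp only; split_ifs
      · exact hr₁s e
      · exact hr e
    obtain ⟨h1, h2⟩ := hft v hv
    rw [(combine r₁ r v).1, (combine r₁ r v).2, add_right_comm]
    generalize ∑ u ∈ T, f v u + ∑ e ∈ R, r e * endsAt a b e v = N at *
    rw [abs_lt] at h2
    refine ⟨by rwa [← sub_add, sub_add_eq_add_sub] at h1, ?_⟩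
    rcases hmat.sum_endsAt v with h4 | ⟨e, he, hev, h4⟩
    · rw [h4]
      rcases hε v with h5 | h5 <;> rw [h5] <;> omega
    · rw [h4] at h1 ⊢
      have hea : ε (a e) = ε v := by
        rcases hev with rfl | rfl
        · rfl
        · exact hεM e he
      by_cases hab : a e = b e
      · have hae : a e = v := by rcases hev with h | h <;> simp [h, hab]
        have hbe : b e = v := hab ▸ hae
        simp only [hr₁, endsAt, unitAt, hae, hbe, if_true, true_and] at h1 ⊢
        have hdvd : 2 * k ∣ ε v * τ v - 1 → 2 * k ∣ ε v * (N - 2 * ε v) - 1 := by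
          intro h6
          rw [if_pos h6] at h1
          have := (h1.mul_left (ε v)).add h6
          rwa [show ε v * (N - (τ v - -ε v * (1 + 1))) + (ε v * τ v - 1) =
            ε v * (N - 2 * ε v) - 1 by ring] at this
        have hdvd' : ¬ 2 * k ∣ ε v * τ v - 1 → ¬ 2 * k ∣ ε v * (N + 2 * ε v) - 1 := by
          intro h6 h7
          rw [if_neg h6] at h1
          apply h6
          have := h7.sub (h1.mul_left (ε v))
          rwa [show ε v * (N + 2 * ε v) - 1 - ε v * (N - (τ v - ε v * (1 + 1))) =
            ε v * τ v - 1 by ring] at this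
        have hsq : ε v * ε v = 1 := by rcases hε v with h5 | h5 <;> rw [h5] <;> rfl
        by_cases h6 : 2 * k ∣ ε v * τ v - 1
        · rw [if_pos h6]
          have h7 := hdvd h6
          have e1 : ε v * (N - 2 * ε v) = ε v * N - 2 := by linear_combination -2 * hsq
          have e2 : ε v * (N + -ε v * (1 + 1)) = ε v * N - 2 := by linear_combination -2 * hsq
          rw [e1] at h7
          rw [e2]
          have h8 : -(2 * k) < ε v * N ∧ ε v * N < 2 * k := by
            rcases hε v with h5 | h5 <;> rw [h5] <;> omega
          refine ⟨?_, by omega⟩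
          by_contra h9
          obtain ⟨y, hy⟩ := h7
          have hy1 : y < 0 := by nlinarith
          have hy2 : -2 < y := by nlinarith
          have : y = -1 := by omega
          subst this
          omega
        · rw [if_neg h6]
          have h7 := hdvd' h6
          have e1 : ε v * (N + 2 * ε v) = ε v * N + 2 := by linear_combination 2 * hsq
          have e2 : ε v * (N + ε v * (1 + 1)) = ε v * N + 2 := by linear_combination 2 * hsq
          rw [e1] at h7
          rw [e2]
          have h8 : -(2 * k) < ε v * N ∧ ε v * N < 2 * k := by
            rcases hε v with h5 | h5 <;> rw [h5] <;> omega
          refine ⟨by omega, ?_⟩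
          by_contra h9
          exact h7 ⟨1, by omega⟩
      · have h6 : endsAt a b e v = 1 := by
          simp only [endsAt, unitAt]
          rcases hev with rfl | rfl
          · simp [hab]
          · simp [Ne.symm hab]
        rw [h6]
        simp only [hr₁, hab, false_and, if_false, hea]
        rcases hε v with h5 | h5 <;> rw [h5] <;> omega


lemma exists_common_end {a b : ι → V} {M : Finset ι} (hM : ¬ IsMatching a b M) :
    ∃ e ∈ M, ∃ e' ∈ M, e ≠ e' ∧ ∃ p w q, (∀ v, endsAt a b e v = unitAt p v + unitAt w v) ∧
      (∀ v, endsAt a b e' v = unitAt w v + unitAt q v) ∧ (p = a e ∨ p = b e) ∧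
      (q = a e' ∨ q = b e') := by
  simp only [IsMatching, not_forall] at hM
  obtain ⟨e, he, e', he', hne, h⟩ := hM
  refine ⟨e, he, e', he', hne, ?_⟩
  by_cases h1 : a e = a e'
  · exact ⟨b e, a e, b e', fun v => by rw [endsAt, add_comm], fun v => by rw [endsAt, h1],
      Or.inr rfl, Or.inr rfl⟩
  by_cases h2 : a e = b e'
  · exact ⟨b e, a e, a e', fun v => by rw [endsAt, add_comm],
      fun v => by rw [endsAt, h2, add_comm], Or.inr rfl, Or.inl rfl⟩
  by_cases h3 : b e = a e'
  · exact ⟨a e, b e, b e', fun v => rfl, fun v => by rw [endsAt, h3], Or.inl rfl, Or.inr rfl⟩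
  by_cases h4 : b e = b e'
  · exact ⟨a e, b e, a e', fun v => rfl, fun v => by rw [endsAt, h4, add_comm], Or.inl rfl,
      Or.inl rfl⟩
  exact absurd ⟨h1, h2, h3, h4⟩ h

lemma exists_signs_of_flow_and_edges [DecidableEq ι] {k : ℤ} (hk : 1 ≤ k) {T : Finset V}
    {R : Finset ι} {a b : ι → V} (hR : ∀ e ∈ R, a e ∈ T ∧ b e ∈ T)
    (hRk : (R.card : ℤ) ≤ k - 1) {ε τ : V → ℤ} (hε : ∀ v, IsSign (ε v)) (M : Finset ι)
    (m : V → V → ℤ) (hs : ∀ u v, m u v = m v u) (h0 : ∀ u v, 0 ≤ m u v) (hd : ∀ u, m u u = 0)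
    (hcut : ∀ A ⊆ T, A ≠ T → A.Nonempty → 3 * k - 3 ≤ ∑ u ∈ A, ∑ v ∈ T \ A, m u v)
    (hMR : Disjoint M R) (hM : ∀ e ∈ M, a e ∈ T ∧ b e ∈ T)
    (hεM : ∀ e ∈ M, ε (a e) = ε (b e))
    (hpar : ∀ v ∈ T, 2 ∣ τ v + ∑ u ∈ T, m v u + ∑ e ∈ M, endsAt a b e v +
      ∑ e ∈ R, endsAt a b e v)
    (hreal : ∀ D : ℤ, |D| ≤ M.card → 2 ∣ D + M.card → ∃ P : ℕ, P ≤ R.card ∧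
      2 * k ∣ ∑ v ∈ T, τ v - 2 * D - 2 * (2 * P - R.card)) :
    ∃ (f : V → V → ℤ) (r : ι → ℤ), IsFlow T m f ∧ (∀ e, IsSign (r e)) ∧ ∀ v ∈ T,
      2 * k ∣ ∑ u ∈ T, f v u + ∑ e ∈ M, r e * endsAt a b e v +
        ∑ e ∈ R, r e * endsAt a b e v - τ v ∧
      -(2 * k) + 1 ≤ ε v * (∑ u ∈ T, f v u + ∑ e ∈ M, r e * endsAt a b e v +
        ∑ e ∈ R, r e * endsAt a b e v) ∧
      ε v * (∑ u ∈ T, f v u + ∑ e ∈ M, r e * endsAt a b e v +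
        ∑ e ∈ R, r e * endsAt a b e v) ≤ 2 * k := by
  induction hn : M.card using Nat.strong_induction_on generalizing M m with
  | _ n ih =>
  subst hn
  by_cases hmat : IsMatching a b M
  · exact exists_signs_of_isMatching hk hs h0 hd hcut hMR hM hR hRk hε hεM hpar hreal hmat
  obtain ⟨e, he, e', he', hne, p, w, q, hp, hq, hpe, hqe⟩ := exists_common_end hmat
  set M' := (M.erase e).erase e' with hM'
  have he'M : e' ∈ M.erase e := Finset.mem_erase.2 ⟨hne.symm, he'⟩
  have hcard : M'.card + 2 = M.card := by
    have h1 := Finset.card_erase_add_one he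
    have h2 := Finset.card_erase_add_one he'M
    rw [← hM'] at h2
    omega
  have hsub : M' ⊆ M := (Finset.erase_subset _ _).trans (Finset.erase_subset _ _)
  have hsum : ∀ F : ι → ℤ, ∑ i ∈ M, F i = ∑ i ∈ M', F i + F e' + F e := by
    intro F
    rw [hM', Finset.sum_erase_add _ _ he'M, Finset.sum_erase_add _ _ he]
  have hMR' : Disjoint M' R := Finset.disjoint_of_subset_left hsub hMR
  have heM' : e ∉ M' := by simp [hM']
  have he'M' : e' ∉ M' := by simp [hM']
  have heR : e ∉ R := Finset.disjoint_left.1 hMR he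
  have he'R : e' ∉ R := Finset.disjoint_left.1 hMR he'
  have hreal' : ∀ D : ℤ, |D| ≤ M'.card → 2 ∣ D + M'.card → ∃ P : ℕ, P ≤ R.card ∧
      2 * k ∣ ∑ v ∈ T, τ v - 2 * D - 2 * (2 * P - R.card) :=
    fun D h1 h2 => hreal D (by omega) (by omega)
  have hpT : p ∈ T := by
    rcases hpe with rfl | rfl
    · exact (hM e he).1
    · exact (hM e he).2
  have hqT : q ∈ T := by
    rcases hqe with rfl | rfl
    · exact (hM e' he').1
    · exact (hM e' he').2
  have lift : ∀ (r : ι → ℤ) (s : ℤ) (v : V),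
      ∑ i ∈ M, (if i = e then s else if i = e' then -s else r i) * endsAt a b i v =
        ∑ i ∈ M', r i * endsAt a b i v + s * (unitAt p v - unitAt q v) ∧
      ∑ i ∈ R, (if i = e then s else if i = e' then -s else r i) * endsAt a b i v =
        ∑ i ∈ R, r i * endsAt a b i v := by
    intro r s v
    constructor
    · rw [hsum, if_pos rfl, if_neg hne.symm, if_pos rfl, hp, hq, Finset.sum_congr rfl fun i hi => by
        rw [if_neg (by rintro rfl; exact heM' hi), if_neg (by rintro rfl; exact he'M' hi)]]
      ring
    · exact Finset.sum_congr rfl fun i hi => by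
        rw [if_neg (by rintro rfl; exact heR hi), if_neg (by rintro rfl; exact he'R hi)]
  have hsign : ∀ (r : ι → ℤ) (s : ℤ), (∀ i, IsSign (r i)) → IsSign s →
      ∀ i, IsSign (if i = e then s else if i = e' then -s else r i) := by
    intro r s hr hs i
    split_ifs
    · exact hs
    · rcases hs with rfl | rfl <;> simp [IsSign]
    · exact hr i
  by_cases hpq : p = q
  · subst hpq
    obtain ⟨f, r, hf, hr, hft⟩ := ih M'.card (by omega) M' m hs h0 hd hcut hMR'
      (fun i hi => hM i (hsub hi)) (fun i hi => hεM i (hsub hi)) (fun v hv => by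
        have h1 := hpar v hv
        rw [hsum, hp, hq] at h1
        omega) hreal' rfl
    refine ⟨f, fun i => if i = e then 1 else if i = e' then -1 else r i, hf,
      hsign r 1 hr (Or.inl rfl), fun v hv => ?_⟩
    rw [(lift r 1 v).1, (lift r 1 v).2, sub_self, mul_zero, add_zero]
    exact hft v hv
  · obtain ⟨f, r, hf, hr, hft⟩ := ih M'.card (by omega) M'
      (fun u v => m u v + edgeAt p q u v)
      (fun u v => by rw [hs u v, edgeAt_symm]) (fun u v => add_nonneg (h0 u v) (edgeAt_nonneg _ _ _ _))
      (fun u => by rw [hd, edgeAt_self hpq]; rfl) (fun A hA hAT hA0 => by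
        refine (hcut A hA hAT hA0).trans ?_
        exact Finset.sum_le_sum fun u _ => Finset.sum_le_sum fun v _ =>
          le_add_of_nonneg_right (edgeAt_nonneg _ _ _ _)) hMR'
      (fun i hi => hM i (hsub hi)) (fun i hi => hεM i (hsub hi)) (fun v hv => by
        have h1 := hpar v hv
        rw [hsum, hp, hq] at h1
        have h2 : ∑ u ∈ T, edgeAt p q v u = unitAt p v + unitAt q v := by
          simp only [edgeAt, Finset.sum_add_distrib, sum_row_ite _ _ _ _ hpT,
            sum_row_ite _ _ _ _ hqT, unitAt]
        rw [Finset.sum_add_distrib, h2]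
        omega) hreal' rfl
    obtain ⟨s, hss, hf1⟩ := hf.remove_edge hpq hpT hqT (hs p q) (h0 p q)
    refine ⟨_, fun i => if i = e then s else if i = e' then -s else r i, hf1,
      hsign r s hr hss, fun v hv => ?_⟩
    rw [(lift r s v).1, (lift r s v).2, Finset.sum_sub_distrib, ← Finset.mul_sum,
      sum_arcAt hpT hqT, sub_add_add_cancel]
    exact hft v hv


/-- The indicator of the edge `e` having exactly one end in `A`. -/
def crosses (a b : ι → V) (A : Finset V) (e : ι) : ℤ := if (a e ∈ A ↔ b e ∈ A) then 0 else 1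

lemma exists_signs_of_crosses [DecidableEq ι] {k : ℤ} (hk : 1 ≤ k) {T : Finset V}
    {B U : Finset ι} {a b : ι → V} (hBU : Disjoint B U)
    (hB : ∀ e ∈ B, a e ∈ T ∧ b e ∈ T ∧ a e ≠ b e) (hU : ∀ e ∈ U, a e ∈ T ∧ b e ∈ T)
    (hcut : ∀ A ⊆ T, A ≠ T → A.Nonempty → 3 * k - 3 ≤ ∑ e ∈ B, crosses a b A e)
    {ε τ : V → ℤ} (hε : ∀ v, IsSign (ε v)) (hεU : ∀ e ∈ U, ε (a e) = ε (b e))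
    (hpar : ∀ v ∈ T, 2 ∣ τ v + ∑ e ∈ B, endsAt a b e v + ∑ e ∈ U, endsAt a b e v)
    {P₀ : ℕ} (hP₀ : P₀ ≤ U.card) (hclass : 2 * k ∣ ∑ v ∈ T, τ v - 2 * (2 * P₀ - U.card)) :
    ∃ r : ι → ℤ, (∀ e, IsSign (r e)) ∧ ∀ v ∈ T,
      2 * k ∣ ∑ e ∈ B, r e * (unitAt (a e) v - unitAt (b e) v) +
        ∑ e ∈ U, r e * endsAt a b e v - τ v ∧
      -(2 * k) + 1 ≤ ε v * (∑ e ∈ B, r e * (unitAt (a e) v - unitAt (b e) v) +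
        ∑ e ∈ U, r e * endsAt a b e v) ∧
      ε v * (∑ e ∈ B, r e * (unitAt (a e) v - unitAt (b e) v) +
        ∑ e ∈ U, r e * endsAt a b e v) ≤ 2 * k := by
  obtain ⟨R, hRU, hRk, hreal⟩ : ∃ R ⊆ U, (R.card : ℤ) ≤ k - 1 ∧ ∀ D : ℤ, |D| ≤ (U \ R).card →
      2 ∣ D + (U \ R).card → ∃ P : ℕ, P ≤ R.card ∧
      2 * k ∣ ∑ v ∈ T, τ v - 2 * D - 2 * (2 * P - R.card) := by
    by_cases hUk : (U.card : ℤ) ≤ k - 1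
    · refine ⟨U, Finset.Subset.refl U, hUk, fun D hD _ => ⟨P₀, hP₀, ?_⟩⟩
      have : D = 0 := by simpa using hD
      rw [this, mul_zero, sub_zero]
      exact hclass
    · obtain ⟨R, hRU, hR⟩ := Finset.exists_subset_card_eq (s := U) (n := (k - 1).toNat) (by omega)
      refine ⟨R, hRU, by omega, fun D _ hD => ?_⟩
      have hc := Finset.card_sdiff_add_card_eq_card hRU
      obtain ⟨p, hp⟩ := hD
      have h1 := Int.emod_nonneg (P₀ - p) (show k ≠ 0 by omega)
      have h2 := Int.emod_lt_of_pos (P₀ - p) (show 0 < k by omega)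
      have h3 := Int.emod_add_mul_ediv (P₀ - p) k
      refine ⟨((P₀ - p) % k).toNat, by omega, ?_⟩
      rw [Int.toNat_of_nonneg h1]
      have h4 : ((U.card : ℕ) : ℤ) = (U \ R).card + R.card := by exact_mod_cast hc.symm
      have h5 : ∑ v ∈ T, τ v - 2 * D - 2 * (2 * ((P₀ - p) % k) - R.card) =
          ∑ v ∈ T, τ v - 2 * (2 * P₀ - U.card) + 2 * k * (2 * ((P₀ - p) / k)) := by
        rw [h4]; linear_combination -2 * hp - 4 * h3
      rw [h5]
      exact dvd_add hclass (dvd_mul_right _ _)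
  set m : V → V → ℤ := fun u v => ∑ e ∈ B, edgeAt (a e) (b e) u v with hm
  have hUs : ∀ F : ι → ℤ, ∑ e ∈ U \ R, F e + ∑ e ∈ R, F e = ∑ e ∈ U, F e :=
    fun F => Finset.sum_sdiff hRU
  obtain ⟨f, r, hf, hr, hft⟩ := exists_signs_of_flow_and_edges hk
    (fun e he => hU e (hRU he)) hRk hε (τ := τ) (U \ R) m
    (fun u v => Finset.sum_congr rfl fun _ _ => edgeAt_symm _ _ _ _)
    (fun u v => Finset.sum_nonneg fun _ _ => edgeAt_nonneg _ _ _ _)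
    (fun u => Finset.sum_eq_zero fun e he => edgeAt_self (hB e he).2.2 u)
    (fun A hA hAT hA0 => by
      have h1 : ∑ u ∈ A, ∑ v ∈ T \ A, m u v = ∑ e ∈ B, crosses a b A e := by
        simp only [hm]
        rw [Finset.sum_congr rfl fun u _ => Finset.sum_comm, Finset.sum_comm]
        exact Finset.sum_congr rfl fun e he => sum_cross_edgeAt (hB e he).1 (hB e he).2.1
      rw [h1]; exact hcut A hA hAT hA0)
    Finset.sdiff_disjoint (fun e he => hU e (Finset.mem_sdiff.1 he).1)
    (fun e he => hεU e (Finset.mem_sdiff.1 he).1)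
    (fun v hv => by
      have h1 : ∑ u ∈ T, m v u = ∑ e ∈ B, endsAt a b e v := by
        simp only [hm]
        rw [Finset.sum_comm]
        refine Finset.sum_congr rfl fun e he => ?_
        simp only [edgeAt, Finset.sum_add_distrib, sum_row_ite _ _ _ _ (hB e he).1,
          sum_row_ite _ _ _ _ (hB e he).2.1, unitAt, endsAt]
      have h2 := hpar v hv
      rw [← hUs, ← add_assoc] at h2
      rwa [h1])
    hreal
  obtain ⟨r', hr', hft'⟩ := hf.exists_signs B hB
  refine ⟨fun e => if e ∈ B then r' e else r e, fun e => ?_, fun v hv => ?_⟩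
  · dsimp only
    split_ifs
    · exact hr' e
    · exact hr e
  · have h1 := hft v hv
    rw [add_assoc, hUs fun e => r e * endsAt a b e v, hft' v hv] at h1
    have h2 : ∑ e ∈ B, (if e ∈ B then r' e else r e) * (unitAt (a e) v - unitAt (b e) v) =
        ∑ e ∈ B, r' e * (unitAt (a e) v - unitAt (b e) v) :=
      Finset.sum_congr rfl fun e he => by rw [if_pos he]
    have h3 : ∑ e ∈ U, (if e ∈ B then r' e else r e) * endsAt a b e v =
        ∑ e ∈ U, r e * endsAt a b e v :=
      Finset.sum_congr rfl fun e he => by rw [if_neg (Finset.disjoint_right.1 hBU he)]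
    rw [h2, h3]
    exact h1

def sideSign (X : Finset V) (v : V) : ℤ := if v ∈ X then 1 else -1

lemma isSign_sideSign (X : Finset V) (v : V) : IsSign (sideSign X v) := by
  simp only [sideSign, IsSign]; split_ifs <;> simp

/-- If the edges crossing `X` have all cuts of size at least `3 * k - 3` then there is a set `S`
of edges with the prescribed degrees modulo `k` and nearly half of the degrees. -/
lemma exists_edges_of_crosses [DecidableEq ι] {k : ℤ} (hk : 1 ≤ k) {T X : Finset V}
    {E : Finset ι} {a b : ι → V} (hE : ∀ e ∈ E, a e ∈ T ∧ b e ∈ T)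
    (hcut : ∀ A ⊆ T, A ≠ T → A.Nonempty →
      3 * k - 3 ≤ ∑ e ∈ E, crosses a b X e * crosses a b A e) {F : V → ℤ}
    {P₀ : ℕ} (hP₀ : P₀ ≤ (E.filter fun e => (a e ∈ X ↔ b e ∈ X)).card)
    (hclass : k ∣ ∑ v ∈ T, sideSign X v * F v -
      2 * (P₀ - (E.filter fun e => a e ∉ X ∧ b e ∉ X).card)) :
    ∃ S ⊆ E, ∀ v ∈ T, k ∣ ∑ e ∈ S, endsAt a b e v - F v ∧
      2 * ∑ e ∈ S, endsAt a b e v ≤ ∑ e ∈ E, endsAt a b e v + 2 * k ∧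
      ∑ e ∈ E, endsAt a b e v - 2 * k + 1 ≤ 2 * ∑ e ∈ S, endsAt a b e v := by
  set U := E.filter fun e => (a e ∈ X ↔ b e ∈ X) with hU
  set B := E.filter fun e => ¬ (a e ∈ X ↔ b e ∈ X) with hB
  have hsplit : ∀ G : ι → ℤ, ∑ e ∈ B, G e + ∑ e ∈ U, G e = ∑ e ∈ E, G e := fun G => by
    rw [add_comm]; exact Finset.sum_filter_add_sum_filter_not E _ G
  set d : V → ℤ := fun v => ∑ e ∈ E, endsAt a b e v with hd
  have hsq : ∀ v, sideSign X v * sideSign X v = 1 := by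
    intro v; simp only [sideSign]; split_ifs <;> rfl
  have hεd : ∑ v ∈ T, sideSign X v * d v =
      2 * U.card - 4 * (E.filter fun e => a e ∉ X ∧ b e ∉ X).card := by
    have h1 : ∀ e ∈ E, ∑ v ∈ T, sideSign X v * endsAt a b e v =
        2 * (if (a e ∈ X ↔ b e ∈ X) then 1 else 0) - 4 * (if a e ∉ X ∧ b e ∉ X then 1 else 0) := by
      intro e he
      have h2 : ∀ c ∈ T, ∑ v ∈ T, sideSign X v * unitAt c v = sideSign X c := by
        intro c hc; simp [unitAt, hc]
      simp only [endsAt, mul_add, Finset.sum_add_distrib, h2 _ (hE e he).1, h2 _ (hE e he).2]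
      simp only [sideSign]
      by_cases h3 : a e ∈ X <;> by_cases h4 : b e ∈ X <;> simp [h3, h4]
    simp only [hd, Finset.mul_sum]
    rw [Finset.sum_comm, Finset.sum_congr rfl h1, Finset.sum_sub_distrib, ← Finset.mul_sum,
      ← Finset.mul_sum, Finset.sum_boole, Finset.sum_boole]
  obtain ⟨r, hr, hrt⟩ := exists_signs_of_crosses hk (T := T) (B := B) (U := U) (a := a) (b := b)
    (ε := sideSign X) (τ := fun v => sideSign X v * (2 * F v - d v)) (P₀ := P₀)
    (by
      rw [Finset.disjoint_left]; intro e h1 h2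
      exact (Finset.mem_filter.1 h1).2 (Finset.mem_filter.1 h2).2)
    (fun e he => by
      rw [hB, Finset.mem_filter] at he
      exact ⟨(hE e he.1).1, (hE e he.1).2, fun h => he.2 (by rw [h])⟩)
    (fun e he => hE e (Finset.mem_filter.1 he).1)
    (fun A hA hAT hA0 => by
      have h1 : ∑ e ∈ E, crosses a b X e * crosses a b A e = ∑ e ∈ B, crosses a b A e := by
        rw [hB, Finset.sum_filter]
        refine Finset.sum_congr rfl fun e _ => ?_
        simp only [crosses]
        split_ifs <;> simp_all
      rw [← h1]; exact hcut A hA hAT hA0)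
    (isSign_sideSign X)
    (fun e he => by
      have := (Finset.mem_filter.1 he).2
      simp only [sideSign, this])
    (fun v _ => by
      rw [add_assoc, hsplit fun e => endsAt a b e v]
      rcases isSign_sideSign X v with h | h <;> rw [h] <;> simp only [hd] <;> omega)
    hP₀
    (by
      obtain ⟨z, hz⟩ := hclass
      refine ⟨z, ?_⟩
      have h1 : ∑ v ∈ T, sideSign X v * (2 * F v - d v) =
          2 * ∑ v ∈ T, sideSign X v * F v - ∑ v ∈ T, sideSign X v * d v := by
        rw [Finset.mul_sum, ← Finset.sum_sub_distrib]
        exact Finset.sum_congr rfl fun v _ => by ring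
      rw [h1, hεd]
      linear_combination 2 * hz)
  have hs : ∀ e, IsSign (sideSign X (a e) * r e) := fun e => by
    rcases isSign_sideSign X (a e) with h | h <;> rcases hr e with h' | h' <;>
      simp [h, h', IsSign]
  refine ⟨E.filter fun e => sideSign X (a e) * r e = 1, Finset.filter_subset _ _, fun v hv => ?_⟩
  obtain ⟨h1, h2, h3⟩ := hrt v hv
  have h4 : sideSign X v * (∑ e ∈ B, r e * (unitAt (a e) v - unitAt (b e) v) +
      ∑ e ∈ U, r e * endsAt a b e v) = ∑ e ∈ E, sideSign X (a e) * r e * endsAt a b e v := by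
    rw [← hsplit, mul_add, Finset.mul_sum, Finset.mul_sum]
    congr 1
    · refine Finset.sum_congr rfl fun e he => ?_
      have := (Finset.mem_filter.1 he).2
      simp only [endsAt, unitAt, sideSign]
      split_ifs <;> subst_vars <;> first | (exfalso; tauto) | ring1 | (exfalso; simp_all)
    · refine Finset.sum_congr rfl fun e he => ?_
      have := (Finset.mem_filter.1 he).2
      simp only [endsAt, unitAt, sideSign]
      split_ifs <;> subst_vars <;> first | (exfalso; tauto) | ring1
  have h5 : ∑ e ∈ E, sideSign X (a e) * r e * endsAt a b e v =
      2 * ∑ e ∈ E with sideSign X (a e) * r e = 1, endsAt a b e v - d v := by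
    rw [Finset.sum_filter, Finset.mul_sum, ← Finset.sum_sub_distrib]
    refine Finset.sum_congr rfl fun e _ => ?_
    rcases hs e with h | h <;> rw [h]
    · rw [if_pos rfl]; ring
    · rw [if_neg (by norm_num)]; ring
  rw [h4, h5] at h2 h3
  have hdv : d v = ∑ e ∈ E, endsAt a b e v := rfl
  refine ⟨?_, by omega, by omega⟩
  have h6 := h1.mul_left (sideSign X v)
  rw [mul_sub, h4, h5, ← mul_assoc, hsq] at h6
  obtain ⟨z, hz⟩ := h6
  exact ⟨z, by linarith⟩

lemma exists_max_crosses (T : Finset V) (E : Finset ι) (a b : ι → V) :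
    ∃ X ⊆ T, ∀ A ⊆ T, ∑ e ∈ E, crosses a b A e ≤
      2 * ∑ e ∈ E, crosses a b X e * crosses a b A e := by
  obtain ⟨X, hX, hmax⟩ := Finset.exists_max_image T.powerset
    (fun X => ∑ e ∈ E, crosses a b X e) ⟨∅, by simp⟩
  rw [Finset.mem_powerset] at hX
  refine ⟨X, hX, fun A hA => ?_⟩
  have h1 := hmax (symmDiff X A) (Finset.mem_powerset.2 fun v hv => by
    rcases Finset.mem_symmDiff.1 hv with h | h
    · exact hX h.1
    · exact hA h.1)
  have h2 : ∀ e ∈ E, crosses a b (symmDiff X A) e =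
      crosses a b X e + crosses a b A e - 2 * (crosses a b X e * crosses a b A e) := by
    intro e _
    simp only [crosses, Finset.mem_symmDiff]
    by_cases h1 : a e ∈ X <;> by_cases h2 : b e ∈ X <;> by_cases h3 : a e ∈ A <;>
      by_cases h4 : b e ∈ A <;> simp [h1, h2, h3, h4]
  rw [Finset.sum_congr rfl h2, Finset.sum_sub_distrib, Finset.sum_add_distrib,
    ← Finset.mul_sum] at h1
  omega

end Signs

section Graphs

variable {α β : Type*} [DecidableEq α] {G : Graph α β} {a b : E(G) → α}

omit [DecidableEq α] in
lemma mem_image_val_filter (S : Finset E(G)) (p : E(G) → Prop) [DecidablePred p] (e : E(G)) :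
    (e : β) ∈ Subtype.val '' (S.filter p : Set E(G)) ↔ e ∈ S ∧ p e := by
  constructor
  · rintro ⟨e', he', h⟩
    rw [Subtype.ext h] at he'
    simpa using he'
  · intro h
    exact ⟨e, by simpa using h, rfl⟩

omit [DecidableEq α] in
lemma ncard_eq_card_filter (S : Finset E(G)) (p : E(G) → Prop) [DecidablePred p] {A : Set β}
    (hA : A ⊆ E(G)) (h : ∀ e : E(G), (e : β) ∈ A ↔ e ∈ S ∧ p e) :
    A.ncard = (S.filter p).card := by
  have : A = Subtype.val '' (S.filter p : Set E(G)) := by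
    ext e
    by_cases he : e ∈ E(G)
    · rw [h ⟨e, he⟩, ← mem_image_val_filter]
    · refine ⟨fun h' => absurd (hA h') he, ?_⟩
      rintro ⟨e', -, rfl⟩
      exact absurd e'.2 he
  rw [this, Set.ncard_image_of_injective _ Subtype.val_injective, Set.ncard_coe_finset]

lemma degree_eq_sum_endsAt (hab : ∀ e : E(G), G.IsLink e (a e) (b e)) {S : Finset E(G)}
    {H : Graph α β} (hH : ∀ e x y, H.IsLink e x y ↔ e ∈ Subtype.val '' (S : Set E(G)) ∧
      G.IsLink e x y) (v : α) : (degree H v : ℤ) = ∑ e ∈ S, endsAt a b e v := by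
  have hS : ∀ e : E(G), (e : β) ∈ Subtype.val '' (S : Set E(G)) ↔ e ∈ S := by
    intro e
    simp
  have h1 : {e | H.Inc e v}.ncard = (S.filter fun e => a e = v ∨ b e = v).card := by
    refine ncard_eq_card_filter S _ (fun e he => ?_) fun e => ?_
    · obtain ⟨y, hy⟩ := he
      exact ((hH _ _ _).1 hy).2.edge_mem
    · constructor
      · rintro ⟨y, hy⟩
        rw [hH, hS] at hy
        refine ⟨hy.1, ?_⟩
        rcases (hab e).eq_and_eq_or_eq_and_eq hy.2 with h | h
        · exact Or.inl h.1
        · exact Or.inr h.2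
      · rintro ⟨he, rfl | rfl⟩
        · exact ⟨b e, (hH _ _ _).2 ⟨(hS e).2 he, hab e⟩⟩
        · exact ⟨a e, (hH _ _ _).2 ⟨(hS e).2 he, (hab e).symm⟩⟩
  have h2 : {e | H.IsLoopAt e v}.ncard = (S.filter fun e => a e = v ∧ b e = v).card := by
    refine ncard_eq_card_filter S _ (fun e he => ((hH _ _ _).1 he).2.edge_mem) fun e => ?_
    constructor
    · intro hy
      have hy := (hH _ _ _).1 hy
      rw [hS] at hy
      refine ⟨hy.1, ?_⟩
      rcases (hab e).eq_and_eq_or_eq_and_eq hy.2 with h | h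
      · exact h
      · exact h
    · rintro ⟨he, h1, h2⟩
      refine (hH _ _ _).2 ⟨(hS e).2 he, ?_⟩
      have := hab e
      rwa [h1, h2] at this
  rw [degree, h1, h2, Nat.cast_add, ← Finset.sum_boole, ← Finset.sum_boole,
    ← Finset.sum_add_distrib]
  refine Finset.sum_congr rfl fun e _ => ?_
  simp only [endsAt, unitAt, eq_comm (a := v)]
  by_cases h3 : a e = v <;> by_cases h4 : b e = v <;> simp [h3, h4]

lemma cutSize_eq_sum_crosses [Fintype E(G)] (hab : ∀ e : E(G), G.IsLink e (a e) (b e))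
    (A : Finset α) : (cutSize G A : ℤ) = ∑ e, crosses a b A e := by
  rw [cutSize, ncard_eq_card_filter Finset.univ (fun e => ¬ (a e ∈ A ↔ b e ∈ A)), ← Finset.sum_boole]
  · refine Finset.sum_congr rfl fun e _ => ?_
    simp only [crosses]; split_ifs <;> rfl
  · rintro e ⟨x, y, h, -⟩; exact h.edge_mem
  · intro e
    simp only [Finset.mem_univ, true_and, Set.mem_ofPred_eq, Finset.mem_coe]
    constructor
    · rintro ⟨x, y, h, hx, hy⟩
      rcases (hab e).eq_and_eq_or_eq_and_eq h with ⟨rfl, rfl⟩ | ⟨rfl, rfl⟩ <;> tauto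
    · intro h
      by_cases ha : a e ∈ A
      · exact ⟨_, _, hab e, ha, by tauto⟩
      · exact ⟨_, _, (hab e).symm, by tauto, ha⟩

lemma inducedSize_eq_card [Fintype E(G)] (hab : ∀ e : E(G), G.IsLink e (a e) (b e))
    (A : Finset α) :
    inducedSize G A = (Finset.univ.filter fun e => a e ∈ A ∧ b e ∈ A).card := by
  rw [inducedSize, ncard_eq_card_filter Finset.univ (fun e => a e ∈ A ∧ b e ∈ A)]
  · rintro e ⟨x, y, h, -⟩; exact h.edge_mem
  · intro e
    simp only [Finset.mem_univ, true_and, Set.mem_ofPred_eq, Finset.mem_coe]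
    constructor
    · rintro ⟨x, y, h, hx, hy⟩
      rcases (hab e).eq_and_eq_or_eq_and_eq h with ⟨rfl, rfl⟩ | ⟨rfl, rfl⟩ <;> tauto
    · intro h
      exact ⟨_, _, hab e, h⟩

lemma bipartiteIndex_le [Fintype E(G)] (hab : ∀ e : E(G), G.IsLink e (a e) (b e))
    {X Y : Finset α} (hXY : (X : Set α) ∪ Y = V(G)) (hd : Disjoint X Y) :
    bipartiteIndex G ≤ (Finset.univ.filter fun e => (a e ∈ X ↔ b e ∈ X)).card := by
  have hY : ∀ v ∈ V(G), v ∉ X → v ∈ Y := by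
    intro v hv hvX
    rw [← hXY] at hv
    exact hv.resolve_left hvX
  refine Nat.sInf_le ⟨G.restrict (Subtype.val '' {e : E(G) | ¬ (a e ∈ X ↔ b e ∈ X)}),
    ⟨Graph.restrict_le, rfl⟩, ⟨X, Y, ⟨hXY, Finset.disjoint_coe.2 hd⟩, ?_⟩, ?_⟩
  · rintro e x y ⟨⟨e, he, rfl⟩, h⟩
    have h1 := h.left_mem
    have h2 := h.right_mem
    have h3 := hY x h1
    have h4 := hY y h2
    simp only [Set.mem_ofPred_eq] at he
    simp only [Finset.mem_coe]
    rcases (hab e).eq_and_eq_or_eq_and_eq h with ⟨rfl, rfl⟩ | ⟨rfl, rfl⟩ <;> tauto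
  · symm
    refine ncard_eq_card_filter _ _ Set.sdiff_subset fun e => ?_
    simp [Graph.restrict]

/-- A vertex bipartition `X, Y` for which the degree congruences reduce to one global congruence. -/
lemma exists_bipartition_hasBoundedModFactor {G : Graph α β} (hV : V(G).Finite) (hE : E(G).Finite)
    {k : ℕ} (hk : 1 ≤ k) (f : α → ZMod k) (hG : IsEdgeConnected G (6 * (k : ℤ) - 7)) :
    ∃ X Y : Finset α, (X : Set α) ∪ Y = V(G) ∧ Disjoint X Y ∧
      bipartiteIndex G ≤ inducedSize G X + inducedSize G Y ∧
      ∀ P₀ : ℕ, P₀ ≤ inducedSize G X + inducedSize G Y →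
        (k : ℤ) ∣ ∑ v ∈ X, ((f v).val : ℤ) - ∑ v ∈ Y, ((f v).val : ℤ) -
          2 * (P₀ - inducedSize G Y) → HasBoundedModFactor G f := by
  classical
  have : Fintype E(G) := hE.fintype
  have : NeZero k := ⟨by omega⟩
  choose a b hab using fun e : E(G) => G.exists_isLink_of_mem_edgeSet e.2
  set T := hV.toFinset with hT
  have hends : ∀ e ∈ (Finset.univ : Finset E(G)), a e ∈ T ∧ b e ∈ T := fun e _ =>
    ⟨hV.mem_toFinset.2 (hab e).left_mem, hV.mem_toFinset.2 (hab e).right_mem⟩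
  obtain ⟨X, hXT, hX⟩ := exists_max_crosses T Finset.univ a b
  have hXY : (X : Set α) ∪ (T \ X : Finset α) = V(G) := by
    rw [← Finset.coe_union, Finset.union_sdiff_of_subset hXT, hT, hV.coe_toFinset]
  have hYc : inducedSize G (T \ X : Finset α) =
      (Finset.univ.filter fun e => a e ∉ X ∧ b e ∉ X).card := by
    rw [inducedSize_eq_card hab]
    congr 1
    refine Finset.filter_congr fun e he => ?_
    have := hends e he
    simp [this.1, this.2]
  have hUc : inducedSize G X + inducedSize G (T \ X : Finset α) =
      (Finset.univ.filter fun e => (a e ∈ X ↔ b e ∈ X)).card := by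
    rw [hYc, inducedSize_eq_card hab, ← Finset.card_union_of_disjoint]
    · congr 1
      ext e
      simp only [Finset.mem_union, Finset.mem_filter, Finset.mem_univ, true_and]
      tauto
    · rw [Finset.disjoint_left]
      intro e h1 h2
      simp only [Finset.mem_filter] at h1 h2
      exact h2.2.1 h1.2.1
  refine ⟨X, T \ X, hXY, Finset.disjoint_sdiff, ?_, fun P₀ hP₀ hcl => ?_⟩
  · rw [hUc]; exact bipartiteIndex_le hab hXY Finset.disjoint_sdiff
  have hsign : ∑ v ∈ T, sideSign X v * ((f v).val : ℤ) =
      ∑ v ∈ X, ((f v).val : ℤ) - ∑ v ∈ T \ X, ((f v).val : ℤ) := by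
    have h1 : ∀ v ∈ T \ X, sideSign X v * ((f v).val : ℤ) = -((f v).val : ℤ) := fun v hv => by
      rw [sideSign, if_neg (Finset.mem_sdiff.1 hv).2]; ring
    have h2 : ∀ v ∈ X, sideSign X v * ((f v).val : ℤ) = ((f v).val : ℤ) := fun v hv => by
      rw [sideSign, if_pos hv]; ring
    rw [← Finset.sum_sdiff hXT, Finset.sum_congr rfl h1, Finset.sum_congr rfl h2,
      Finset.sum_neg_distrib]
    ring
  obtain ⟨S, -, hS⟩ := exists_edges_of_crosses (k := k) (by exact_mod_cast hk) hends
    (fun A hA hAT hA0 => by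
      have h1 : (A : Set α) ⊂ V(G) := by
        rw [← hV.coe_toFinset, Finset.coe_ssubset]
        exact hA.ssubset_of_ne hAT
      have h2 := hG A h1 (by exact_mod_cast hA0)
      rw [cutSize_eq_sum_crosses hab] at h2
      have h3 := hX A hA
      omega)
    (F := fun v => ((f v).val : ℤ)) (P₀ := P₀) (hUc ▸ hP₀) (by rw [hsign, ← hYc]; exact hcl)
  have hdG : ∀ v, (degree G v : ℤ) = ∑ e, endsAt a b e v := fun v =>
    degree_eq_sum_endsAt hab (fun e x y => ⟨fun h => ⟨⟨⟨e, h.edge_mem⟩, by simp, rfl⟩, h⟩,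
      fun h => h.2⟩) v
  have hdH : ∀ v, (degree (G.restrict (Subtype.val '' (S : Set E(G)))) v : ℤ) =
      ∑ e ∈ S, endsAt a b e v := fun v =>
    degree_eq_sum_endsAt hab (fun e x y => Iff.rfl) v
  refine ⟨G.restrict (Subtype.val '' (S : Set E(G))), ⟨⟨Graph.restrict_le, rfl⟩, fun v hv => ?_⟩,
    fun v hv => ?_⟩
  · have h1 := (hS v (hV.mem_toFinset.2 hv)).1
    rw [← hdH] at h1
    have h2 := (ZMod.intCast_eq_intCast_iff_dvd_sub _ _ k).2 h1
    simpa using h2.symm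
  · obtain ⟨-, h1, h2⟩ := hS v (hV.mem_toFinset.2 hv)
    rw [← hdH, ← hdG] at h1 h2
    omega

lemma exists_residue_odd {k : ℕ} (hk : Odd k) (Q y : ℤ) :
    ∃ P : ℕ, P < k ∧ (k : ℤ) ∣ Q - 2 * (P - y) := by
  obtain ⟨j, rfl⟩ := hk
  have h1 := Int.emod_nonneg (Q * (j + 1) + y) (b := ((2 * j + 1 : ℕ) : ℤ)) (by omega)
  have h2 := Int.emod_lt_of_pos (Q * (j + 1) + y) (b := ((2 * j + 1 : ℕ) : ℤ)) (by omega)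
  have h3 := Int.emod_add_mul_ediv (Q * (j + 1) + y) ((2 * j + 1 : ℕ) : ℤ)
  refine ⟨((Q * (j + 1) + y) % ((2 * j + 1 : ℕ) : ℤ)).toNat, by omega,
    -Q + 2 * ((Q * (j + 1) + y) / ((2 * j + 1 : ℕ) : ℤ)), ?_⟩
  rw [Int.toNat_of_nonneg h1]
  push_cast at h3 ⊢
  linear_combination -2 * h3

lemma exists_residue_even {j : ℕ} (hj : 0 < j) {Q : ℤ} (hQ : Even Q) (y : ℤ) :
    ∃ P : ℕ, P < j ∧ ((j + j : ℕ) : ℤ) ∣ Q - 2 * (P - y) := by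
  obtain ⟨q, rfl⟩ := hQ
  have h1 := Int.emod_nonneg (q + y) (b := (j : ℤ)) (by omega)
  have h2 := Int.emod_lt_of_pos (q + y) (b := (j : ℤ)) (by omega)
  have h3 := Int.emod_add_mul_ediv (q + y) (j : ℤ)
  refine ⟨((q + y) % (j : ℤ)).toNat, by omega, (q + y) / (j : ℤ), ?_⟩
  rw [Int.toNat_of_nonneg h1]
  push_cast
  linear_combination -2 * h3

end Graphs
end ModFactor

theorem mainTheorem3 {α β : Type*} (G : Graph α β)
    (hV : V(G).Finite) (hE : E(G).Finite)
    (k : ℕ) (hk : 1 ≤ k) (f : α → ZMod k)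
    (hG : ModFactor.IsEdgeConnected G (6 * (k : ℤ) - 7)) :
    (ModFactor.IsCompatible G f → ModFactor.HasBoundedModFactor G f) ∧
    (Even (((k : ℤ) - 1) * ∑ᶠ v ∈ V(G), ((f v).val : ℤ)) →
      (k : ℤ) - 1 ≤ (ModFactor.bipartiteIndex G : ℤ) →
      ModFactor.HasBoundedModFactor G f) ∧
    (Even k →
      Even (((k : ℤ) - 1) * ∑ᶠ v ∈ V(G), ((f v).val : ℤ)) →
      (k : ℚ) / 2 - 1 ≤ (ModFactor.bipartiteIndex G : ℚ) →
      ModFactor.HasBoundedModFactor G f) := by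
  classical
  have : NeZero k := ⟨by omega⟩
  obtain ⟨X, Y, hXY, hd, hbi, hmain⟩ :=
    ModFactor.exists_bipartition_hasBoundedModFactor hV hE hk f hG
  have hsum : ∑ᶠ v ∈ V(G), ((f v).val : ℤ) =
      ∑ v ∈ X, ((f v).val : ℤ) + ∑ v ∈ Y, ((f v).val : ℤ) := by
    rw [← hXY, ← Finset.coe_union, finsum_mem_coe_finset, Finset.sum_union hd]
  have heven : Even k → Even (((k : ℤ) - 1) * ∑ᶠ v ∈ V(G), ((f v).val : ℤ)) →
      Even (∑ v ∈ X, ((f v).val : ℤ) - ∑ v ∈ Y, ((f v).val : ℤ)) := by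
    intro hk2 h
    rw [hsum, Int.even_mul] at h
    have hk' : ¬ Even ((k : ℤ) - 1) := by
      rw [Int.not_even_iff_odd]
      exact Even.sub_odd (by exact_mod_cast hk2) odd_one
    have h1 := h.resolve_left hk'
    rw [Int.even_add] at h1
    rwa [Int.even_sub]
  have hcast : ∀ A : Finset α, ∑ᶠ v ∈ (A : Set α), f v =
      ((∑ v ∈ A, ((f v).val : ℤ) : ℤ) : ZMod k) := by
    intro A
    rw [finsum_mem_coe_finset]
    push_cast
    exact Finset.sum_congr rfl fun v _ => (ZMod.natCast_zmod_val (f v)).symm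
  refine ⟨fun hcomp => ?_, fun h1 h2 => ?_, fun hk2 h1 h2 => ?_⟩
  · rcases hcomp X Y ⟨hXY, Finset.disjoint_coe.2 hd⟩ with ⟨x, hx, h⟩ | ⟨y, hy, h⟩
    · refine hmain (x + ModFactor.inducedSize G Y) (by omega) ?_
      rw [hcast, hcast, ← sub_eq_zero] at h
      rw [← ZMod.intCast_zmod_eq_zero_iff_dvd _ k, ← h]
      push_cast
      ring
    · refine hmain (ModFactor.inducedSize G Y - y) (by omega) ?_
      rw [hcast, hcast, ← sub_eq_zero] at h
      rw [← ZMod.intCast_zmod_eq_zero_iff_dvd _ k, ← h]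
      push_cast [hy]
      ring
  · rcases Nat.even_or_odd k with hk2 | hk2
    · have hQ := heven hk2 h1
      obtain ⟨j, rfl⟩ := hk2
      obtain ⟨P, hP, hPd⟩ := ModFactor.exists_residue_even (j := j) (by omega) hQ
        (ModFactor.inducedSize G Y)
      exact hmain P (by omega) hPd
    · obtain ⟨P, hP, hPd⟩ := ModFactor.exists_residue_odd hk2
        (∑ v ∈ X, ((f v).val : ℤ) - ∑ v ∈ Y, ((f v).val : ℤ)) (ModFactor.inducedSize G Y)
      exact hmain P (by omega) hPd
  · have hQ := heven hk2 h1
    obtain ⟨j, rfl⟩ := hk2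
    obtain ⟨P, hP, hPd⟩ := ModFactor.exists_residue_even (j := j) (by omega) hQ
      (ModFactor.inducedSize G Y)
    have h3 : (j : ℚ) ≤ ModFactor.bipartiteIndex G + 1 := by push_cast at h2; linarith
    have h4 : j ≤ ModFactor.bipartiteIndex G + 1 := by exact_mod_cast h3
    exact hmain P (by omega) hPd
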